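/- Let $\nu>0$ and let $\xi:\mathbb R\to\mathbb R$ be the solution of $\xi'(y)=\xi(y)^{\nu+1}(1-\xi(y))$, $\xi(0)=\frac{\nu+1}{\nu+2}$. For $\alpha,\beta>0$, $\gamma\in\mathbb C$ with $\Re\gamma\ge 0$, and $t>0$ (the variable $t=-\alpha\beta y$) put $$\eta(t)=\alpha^{-1/\nu}\,\xi\!\left(-\tfrac{t}{\alpha\beta}\right),\qquad p(t)=\alpha^{1/\nu}\tfrac{\gamma}{\beta}\,\eta(t),\qquad \psi_0(t)=\tfrac{\gamma}{\beta}\alpha^{1/\nu}\int_{\tau}^{t}\eta(s)\,ds ,$$ where $\tau>0$ is a base point. Let $\kappa\in\{2,3\}$ ($\kappa=3$ is the exponent obtained by deriving the system from the linearized equations, $\kappa=2$ the one printed in the paper), and consider for $Z=(z_1,x_2,x_3,z_4,x_5)\in\mathbb C^5$ the system $\frac{dZ}{dt}=A(t)Z$ given by $$\begin{aligned} \tfrac{dz_1}{dt}&=\tfrac{\eta^\nu}{\beta}(1-\alpha^{1/\nu}\eta)z_1+x_3+\alpha^{1/\nu}\tfrac{\gamma}{\beta^2}\eta^{\nu+1}z_4,\\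 \tfrac{dx_2}{dt}&=p\,z_1-x_3+\alpha^{2/\nu}\tfrac{1}{\beta^{\kappa}}\eta^{\nu+2}z_4,\\ \tfrac{dx_3}{dt}&=2z_1+x_2-p\,x_3+\tfrac{\eta^\nu}{\beta}z_4,\\ \tfrac{dz_4}{dt}&=z_1+\tfrac{\eta^\nu}{\beta}z_4-x_5,\\ \tfrac{dx_5}{dt}&=x_3-z_4 . \end{aligned}$$ Let $M_0(0)$ and $N$ be the constant matrices $M_0(0)Z=(x_3,\,-x_3,\,2z_1+x_2,\,z_1-x_5,\,x_3-z_4)$ and $NZ=(z_1,0,z_4,z_4,0)$. For a $5\times5$ matrix $B$ let $B^{(3)}$ be the operator on $\Lambda^3(\mathbb C^5)$ with $B^{(3)}(u\wedge v\wedge w)=Bu\wedge v\wedge w+u\wedge Bv\wedge w+u\wedge v\wedge Bw$. The full three-form system is $\frac{dU}{dt}=A(t)^{(3)}U$, and the model three-form system is $\frac{d\tilde Z}{dt}=M_0(0)^{(3)}\tilde Z+\frac1{\nu t}N^{(3)}\tilde Z$. With $i_1,\dots,i_5$ the canonical basis of $\mathbb C^5$ and $i_{abc}=i_a\wedge i_b\wedge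 i_c$, let $$P(0)=2\,i_{235}-i_{135}+i_{125}-i_{345}+i_{245}+2\,i_{234}-i_{134}+i_{124}.$$ Let $|\cdot|$ be the supremum norm of the coordinates on $\Lambda^3(\mathbb C^5)$ in the basis $(i_{abc})_{a<b<c}$. 1) For all $\alpha,\beta,\gamma,\tau$ as above there is a solution $U_0$ of the full three-form system on $(0,+\infty)$ with $$\lim_{t\to+\infty}U_0(t)\,e^{2t+\psi_0(t)}\,t^{-\frac1{2\nu}}=P(0),$$ and it is unique: for every $a\ge 0$, any solution on $(a,+\infty)$ with this limit coincides with $U_0$ on $(a,+\infty)$. Moreover, for all $\alpha_0,\beta_0,t_0>0$ there is $C>0$ such that, for all $0<\alpha\le\alpha_0$, $\beta\in[\beta_0,\beta_0^{-1}]$, $|\gamma|\le\beta_0^{-1}$, $\Re\gamma\ge0$, all $\tau>0$ and all $t\ge t_0$, $$|U_0(t)\,e^{2t+\psi_0(t)}|\le C\,t^{\frac1{2\nu}} .$$ 2) There is a solution $\tilde Z$ of the model three-form system on $(0,+\infty)$ with $\tilde Z(t)\,e^{2t}\,t^{-\frac1{2\nu}}\to P(0)$ as $t\to+\infty$, and it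 is unique in the same sense. 3) If $\nu>1$, then for all $\alpha_0,\beta_0,t_0>0$ there is $C(t_0)>0$ (depending on $\nu,\kappa,\alpha_0,\beta_0,t_0$ only) such that, for all $0<\alpha\le\alpha_0$, $\beta\in[\beta_0,\beta_0^{-1}]$, $|\gamma|\le\beta_0^{-1}$, $\Re\gamma\ge0$, all $\tau>0$ and all $t\ge t_0$, $$\left|\tilde Z(t)\,e^{2t}\,t^{-\frac1{2\nu}}-U_0(t)\,e^{2t+\psi_0(t)}\,t^{-\frac1{2\nu}}\right|\le C(t_0)\,\alpha^{\frac1\nu}.$$ -/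

import Mathlib

open Set Filter Topology

namespace KullAnisimov

/-! ### The derivation induced by an endomorphism on an exterior power -/

section Derivation

variable {R M : Type*} [CommRing R] [AddCommGroup M] [Module R M]

/-- The alternating map
`(v₁, …, vₙ) ↦ ∑ₗ v₁ ∧ ⋯ ∧ A vₗ ∧ ⋯ ∧ vₙ`. -/
noncomputable def derivationAlternating (n : ℕ) (A : M →ₗ[R] M) :
    M [⋀^Fin n]→ₗ[R] (⋀[R]^n M) :=
  { (∑ l : Fin n, (exteriorPower.ιMulti R n (M := M)).toMultilinearMap.compLinearMap
      (fun k => if k = l then A else LinearMap.id) :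
        MultilinearMap R (fun _ : Fin n => M) (⋀[R]^n M)) with
    map_eq_zero_of_eq' := by
      intro v i j hv hij
      have key : ∀ l : Fin n, (fun k => (if k = l then A else LinearMap.id) (v k))
          = Function.update v l (A (v l)) := by
        intro l
        funext k
        by_cases hk : k = l
        · subst hk
          simp
        · simp [hk]
      simp only [MultilinearMap.toFun_eq_coe, _root_.sum_apply,
        MultilinearMap.compLinearMap_apply, AlternatingMap.coe_multilinearMap, key]
      rw [← Finset.sum_subset (Finset.subset_univ {i, j})]
      · rw [Finset.sum_pair hij]
        have h : Function.update v j (A (v j))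
            = Function.update v i (A (v i)) ∘ Equiv.swap i j := by
          funext k
          by_cases h1 : k = i
          · subst h1
            simp [hij, hij.symm, hv]
          · by_cases h2 : k = j
            · subst h2
              simp [hv]
            · simp [Equiv.swap_apply_of_ne_of_ne h1 h2, h1, h2]
        rw [h, AlternatingMap.map_swap _ _ hij, add_neg_cancel]
      · intro l _ hl
        simp only [Finset.mem_insert, Finset.mem_singleton, not_or] at hl
        refine AlternatingMap.map_eq_zero_of_eq _ _ (i := i) (j := j) ?_ hij
        rw [Function.update_of_ne (Ne.symm hl.1), Function.update_of_ne (Ne.symm hl.2), hv] }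

/-- The operator `A⁽ⁿ⁾` induced by `A` on the `n`-th exterior power. -/
noncomputable def extDerivation (n : ℕ) (A : M →ₗ[R] M) : ⋀[R]^n M →ₗ[R] ⋀[R]^n M :=
  exteriorPower.alternatingMapLinearEquiv (derivationAlternating n A)

/-- The defining formula `A⁽ⁿ⁾(v₁ ∧ ⋯ ∧ vₙ) = ∑ₗ v₁ ∧ ⋯ ∧ A vₗ ∧ ⋯ ∧ vₙ`. -/
theorem extDerivation_ιMulti (n : ℕ) (A : M →ₗ[R] M) (v : Fin n → M) :
    extDerivation n A (exteriorPower.ιMulti R n v)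
      = ∑ l : Fin n, exteriorPower.ιMulti R n (Function.update v l (A (v l))) := by
  rw [extDerivation, exteriorPower.alternatingMapLinearEquiv_apply_ιMulti]
  change (∑ l : Fin n, (exteriorPower.ιMulti R n (M := M)).toMultilinearMap.compLinearMap
      (fun k => if k = l then A else LinearMap.id) :
        MultilinearMap R (fun _ : Fin n => M) (⋀[R]^n M)) v = _
  rw [_root_.sum_apply]
  refine Finset.sum_congr rfl fun l _ => ?_
  rw [MultilinearMap.compLinearMap_apply, AlternatingMap.coe_multilinearMap]
  refine congrArg _ (funext fun k => ?_)
  by_cases hk : k = l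
  · subst hk
    simp
  · simp [hk]

end Derivation

/-! ### Three-vectors over `ℂ⁵` -/

/-- The third exterior power of `ℂ⁵`. -/
abbrev ThreeVec : Type := ⋀[ℂ]^3 (Fin 5 → ℂ)

/-- Coordinates with respect to the ten vectors `i_a ∧ i_b ∧ i_c`, `a < b < c`. They carry the
topology and the (supremum) norm used on three-vectors. -/
noncomputable def coords : ThreeVec ≃ₗ[ℂ] (Set.powersetCard (Fin 5) 3 → ℂ) :=
  ((Pi.basisFun ℂ (Fin 5)).exteriorPower 3).equivFun

/-- `wedge a b c` is `i_a ∧ i_b ∧ i_c`, the canonical basis `i_1, …, i_5` of `ℂ⁵` being indexed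
here by `0, …, 4`. -/
noncomputable def wedge (a b c : Fin 5) : ThreeVec :=
  exteriorPower.ιMulti ℂ 3 ![Pi.single a 1, Pi.single b 1, Pi.single c 1]

/-- `f₁^⊥ = i₂ ∧ i₃ ∧ i₅`. -/
noncomputable def f1perp : ThreeVec := wedge 1 2 4

/-- `f₂^⊥ = - i₁ ∧ i₃ ∧ i₅`. -/
noncomputable def f2perp : ThreeVec := -wedge 0 2 4

/-- `f₃^⊥ = i₁ ∧ i₂ ∧ i₅`. -/
noncomputable def f3perp : ThreeVec := wedge 0 1 4

/-- `g₁^⊥ = i₃ ∧ i₄ ∧ i₅`. -/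
noncomputable def g1perp : ThreeVec := wedge 2 3 4

/-- `g₂^⊥ = - i₂ ∧ i₄ ∧ i₅`. -/
noncomputable def g2perp : ThreeVec := -wedge 1 3 4

/-- `g₃^⊥ = - i₂ ∧ i₃ ∧ i₄`. -/
noncomputable def g3perp : ThreeVec := -wedge 1 2 3

/-- `g₅^⊥ = i₁ ∧ i₃ ∧ i₄`. -/
noncomputable def g5perp : ThreeVec := wedge 0 2 3

/-- `g₆^⊥ = - i₁ ∧ i₂ ∧ i₄`. -/
noncomputable def g6perp : ThreeVec := -wedge 0 1 3

/-- The three-vector `P(p)`. -/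
noncomputable def P (p : ℂ) : ThreeVec :=
  (2 + p) • f1perp + f2perp + f3perp - g1perp - g2perp - (2 + p) • g3perp - g5perp - g6perp

/-- `U` solves `dU/dt = A(t)⁽³⁾ U` at every point of the (open) set `I`. -/
def IsThreeFormSolution (A : ℝ → Matrix (Fin 5) (Fin 5) ℂ) (I : Set ℝ) (U : ℝ → ThreeVec) :
    Prop :=
  ∀ t ∈ I, HasDerivAt (fun s => coords (U s))
    (coords (extDerivation 3 (Matrix.toLin' (A t)) (U t))) t

/-! ### The density profile -/

/-- `ξ` is the normalized density profile: the solution on `ℝ` of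
`dξ/dy = ξ^(ν+1) (1 - ξ)`, `ξ(0) = (ν+1)/(ν+2)`. -/
structure IsProfile (ν : ℝ) (ξ : ℝ → ℝ) : Prop where
  hasDerivAt : ∀ y, HasDerivAt ξ (ξ y ^ (ν + 1) * (1 - ξ y)) y
  initial : ξ 0 = (ν + 1) / (ν + 2)

/-- The profile exists. -/
theorem exists_isProfile {ν : ℝ} (hν : 0 < ν) : ∃ ξ : ℝ → ℝ, IsProfile ν ξ := by
  -- In the variable `x = log (ξ / (1 - ξ))` the equation is `dy/dx = (1 + exp (-x)) ^ ν`.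
  set g : ℝ → ℝ := fun x => (1 + Real.exp (-x)) ^ ν with hg
  have hpos : ∀ x : ℝ, 0 < 1 + Real.exp (-x) := fun x => by positivity
  have hgc : Continuous g := by
    refine Continuous.rpow_const (by fun_prop) fun x => Or.inl (hpos x).ne'
  have hg1 : ∀ x, 1 ≤ g x := fun x =>
    Real.one_le_rpow (by linarith [Real.exp_pos (-x)]) hν.le
  set x₀ : ℝ := Real.log (ν + 1) with hx₀
  set G : ℝ → ℝ := fun x => ∫ u in x₀..x, g u with hG
  have hGd : ∀ x, HasDerivAt G (g x) x := fun x =>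
    intervalIntegral.integral_hasDerivAt_right (hgc.intervalIntegrable _ _)
      (hgc.stronglyMeasurableAtFilter _ _) hgc.continuousAt
  have hGm : StrictMono G := strictMono_of_hasDerivAt_pos hGd
    fun x => lt_of_lt_of_le one_pos (hg1 x)
  have hGcont : Continuous G := continuous_iff_continuousAt.2 fun x => (hGd x).continuousAt
  have hmono : Monotone fun x => G x - x := by
    refine monotone_of_hasDerivAt_nonneg (f' := fun x => g x - 1)
      (fun x => (hGd x).sub (hasDerivAt_id x)) fun x => by
        have := hg1 x
        simp only [Pi.zero_apply]
        linarith
  have hG0 : G x₀ = 0 := by simp [hG]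
  have htop : Tendsto G atTop atTop := by
    refine tendsto_atTop_mono' _ ?_ (tendsto_atTop_add_const_right _ (-x₀) tendsto_id)
    filter_upwards [eventually_ge_atTop x₀] with x hx
    have := hmono hx
    simp only [hG0, id] at this ⊢
    linarith
  have hbot : Tendsto G atBot atBot := by
    refine tendsto_atBot_mono' _ ?_ (tendsto_atBot_add_const_right _ (-x₀) tendsto_id)
    filter_upwards [eventually_le_atBot x₀] with x hx
    have := hmono hx
    simp only [hG0, id] at this ⊢
    linarith
  have hsurj : Function.Surjective G := hGcont.surjective htop hbot
  set e := hGm.orderIsoOfSurjective G hsurj with he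
  have heG : ∀ x, e x = G x := fun x => rfl
  have hsymm : ∀ y, HasDerivAt (fun y => e.symm y) (g (e.symm y))⁻¹ y := by
    intro y
    refine HasDerivAt.of_local_left_inverse (f := G) e.symm.continuous.continuousAt
      (hGd _) (lt_of_lt_of_le one_pos (hg1 _)).ne' (Eventually.of_forall fun z => ?_)
    rw [← heG, OrderIso.apply_symm_apply]
  refine ⟨fun y => (1 + Real.exp (-e.symm y))⁻¹, ?_, ?_⟩
  · intro y
    set x := e.symm y with hx
    have h1 : HasDerivAt (fun y => 1 + Real.exp (-e.symm y))
        (Real.exp (-x) * -(g x)⁻¹) y := ((hsymm y).neg.exp).const_add 1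
    refine (h1.inv (hpos x).ne').congr_deriv ?_
    symm
    rw [Real.rpow_add (inv_pos.2 (hpos x)), Real.rpow_one, Real.inv_rpow (hpos x).le]
    have h2 := hpos x
    have h3 : 0 < (1 + Real.exp (-x)) ^ ν := Real.rpow_pos_of_pos h2 ν
    simp only [hg, ← hx]
    field_simp
    ring
  · have h0 : e.symm 0 = x₀ := by
      rw [OrderIso.symm_apply_eq, heG, hG0]
    have : (0 : ℝ) < ν + 1 := by linarith
    simp only [h0, hx₀, Real.exp_neg, Real.exp_log this]
    field_simp
    ring

/-! ### The systems -/

/-- `η(t) = ξ(-t/(αβ)) / α^(1/ν)`. -/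
noncomputable def eta (ν : ℝ) (ξ : ℝ → ℝ) (α β t : ℝ) : ℝ :=
  ξ (-t / (α * β)) / α ^ (1 / ν)

/-- `p(t) = α^(1/ν) (γ/β) η(t)`. -/
noncomputable def pFun (ν : ℝ) (ξ : ℝ → ℝ) (α β : ℝ) (γ : ℂ) (t : ℝ) : ℂ :=
  ((α ^ (1 / ν) : ℝ) : ℂ) * (γ / (β : ℂ)) * (eta ν ξ α β t : ℂ)

/-- `ψ₀(t) = (γ/β) α^(1/ν) ∫_τ^t η(s) ds`. -/
noncomputable def psi (ν : ℝ) (ξ : ℝ → ℝ) (α β : ℝ) (γ : ℂ) (τ t : ℝ) : ℂ :=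
  (γ / (β : ℂ)) * ((α ^ (1 / ν) : ℝ) : ℂ) * ((∫ s in τ..t, eta ν ξ α β s : ℝ) : ℂ)

/-- The matrix `A(t)` of the first-order system `dZ/dt = A(t) Z` satisfied by
`Z = (z₁, x₂, x₃, z₄, x₅)`. The coefficient of `z₄` in the second equation is
`α^(2/ν) η^(ν+2) / β^κ`. -/
noncomputable def fullMatrix (κ : ℕ) (ν : ℝ) (ξ : ℝ → ℝ) (α β : ℝ) (γ : ℂ) (t : ℝ) :
    Matrix (Fin 5) (Fin 5) ℂ :=
  let η : ℝ := eta ν ξ α β t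
  let p : ℂ := pFun ν ξ α β γ t
  let a : ℝ := α ^ (1 / ν)
  let q : ℂ := ((η ^ ν / β : ℝ) : ℂ)
  !![q * ((1 - a * η : ℝ) : ℂ), 0, 1, (a : ℂ) * (γ / (β : ℂ) ^ 2) * ((η ^ (ν + 1) : ℝ) : ℂ), 0;
     p, 0, -1, ((α ^ (2 / ν) * (1 / β ^ κ) * η ^ (ν + 2) : ℝ) : ℂ), 0;
     2, 1, -p, q, 0;
     1, 0, 0, q, -1;
     0, 0, 1, -1, 0]

/-- The matrix `M₀(p)`. -/
def M0 (p : ℂ) : Matrix (Fin 5) (Fin 5) ℂ :=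
  !![0, 0, 1, 0, 0;
     p, 0, -1, 0, 0;
     2, 1, -p, 0, 0;
     1, 0, 0, 0, -1;
     0, 0, 1, -1, 0]

/-- The matrix `N : (z₁, x₂, x₃, z₄, x₅) ↦ (z₁, 0, z₄, z₄, 0)`. -/
def N : Matrix (Fin 5) (Fin 5) ℂ :=
  !![1, 0, 0, 0, 0;
     0, 0, 0, 0, 0;
     0, 0, 0, 1, 0;
     0, 0, 0, 1, 0;
     0, 0, 0, 0, 0]

/-- The matrix `M₀(0) + N/(νt)` of the model system. -/
noncomputable def modelMatrix (ν : ℝ) (t : ℝ) : Matrix (Fin 5) (Fin 5) ℂ :=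
  M0 0 + ((1 / (ν * t) : ℝ) : ℂ) • N

/-! ### Normalizations at infinity -/

/-- `U(t) e^{2t+ψ₀(t)} t^{-1/(2ν)}`, where `ψ₀` has base point `τ`. -/
noncomputable def normalizedFull (ν : ℝ) (ξ : ℝ → ℝ) (α β : ℝ) (γ : ℂ) (τ : ℝ)
    (U : ℝ → ThreeVec) (t : ℝ) : ThreeVec :=
  (Complex.exp (2 * (t : ℂ) + psi ν ξ α β γ τ t) * ((t ^ (-(1 / (2 * ν))) : ℝ) : ℂ)) • U t

/-- `Z(t) e^{2t} t^{-1/(2ν)}`. -/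
noncomputable def normalizedModel (ν : ℝ) (Z : ℝ → ThreeVec) (t : ℝ) : ThreeVec :=
  (Complex.exp (2 * (t : ℂ)) * ((t ^ (-(1 / (2 * ν))) : ℝ) : ℂ)) • Z t

/-- Convergence to `P(0)` when `t → +∞`. -/
def TendstoP0 (V : ℝ → ThreeVec) : Prop :=
  Tendsto (fun t => coords (V t)) atTop (𝓝 (coords (P 0)))

/-- `U` solves the full three-form system on `I` and has the normalization
`U(t) e^{2t+ψ₀(t)} t^{-1/(2ν)} → P(0)`. -/
def IsNormalizedFull (κ : ℕ) (ν : ℝ) (ξ : ℝ → ℝ) (α β : ℝ) (γ : ℂ) (τ : ℝ) (I : Set ℝ)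
    (U : ℝ → ThreeVec) : Prop :=
  IsThreeFormSolution (fullMatrix κ ν ξ α β γ) I U ∧
    TendstoP0 (normalizedFull ν ξ α β γ τ U)

/-- `Z` solves the model three-form system on `I` and has the normalization
`Z(t) e^{2t} t^{-1/(2ν)} → P(0)`. -/
def IsNormalizedModel (ν : ℝ) (I : Set ℝ) (Z : ℝ → ThreeVec) : Prop :=
  IsThreeFormSolution (modelMatrix ν) I Z ∧ TendstoP0 (normalizedModel ν Z)

/-- The range of the parameters over which the constants are uniform. -/
def ParamRange (α₀ β₀ α β : ℝ) (γ : ℂ) : Prop :=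
  0 < α ∧ α ≤ α₀ ∧ β₀ ≤ β ∧ β ≤ 1 / β₀ ∧ 0 ≤ γ.re ∧ ‖γ‖ ≤ 1 / β₀

end KullAnisimov

/-!
Multiplying a solution of either three-form system by its prescribed normalizing factor turns it
into a solution `V` of `V' = (L + p(t) D + G / t + R(t)) V` which has to converge to `P(0)`. Here
`L = M₀(0)⁽³⁾ + 2` and, for the model system, `p = 0` and `R = 0`. The matrix `M₀(0)` is
diagonalizable with eigenvalues `0, -1, -1, 1, 1`, hence `L` is diagonal in the basis of triple
wedge products of eigenvectors; its kernel is spanned by `P(0)`, which is one of these products, and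
its other eigenvalues are at least `1` (`splitData`).

Neither `p(t)`, of order `t^(-1/ν)`, nor `1/t` is integrable at infinity. What saves the argument is
that `M₀(p)⁽³⁾` has the exact eigenvalue `-(2 + p)` with a left eigenvector `leftForm p` which is
affine in `p` (`leftForm_eq`, `leftForm_extDerivation`), and that the first-order effect of
`N⁽³⁾ / (νt)` on this eigenvalue is exactly `1 / (2νt)` (`leftForm_N_triBasis_slow`). The scalar
`c = leftForm (p(t)) V` therefore satisfies `|c'| ≤ K |fast coordinates| / t + O(t^(-1-σ)) |V|`,
while each fast coordinate satisfies `y' = λ y + O(t^(-σ)) |V|` with `λ ≥ 1` and is recovered by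
integrating backwards from infinity, with a gain of a factor `t^(-σ)`. For large `t` this closes
(`SplitData.norm_sub_le_of_approx`): a solution with a limit converges to a multiple of `P(0)` at
the rate `t^(-σ)`, uniformly in the parameters. This gives uniqueness; existence follows by
compactness from the solutions equal to `P(0)` at time `S`, as `S → ∞`
(`SplitData.exists_tendsto`); the bounds propagate from large times to `[t₀, ∞)` by Grönwall's
inequality. The same estimate, applied to the difference of the two normalized solutions, gives the
comparison (`SplitData.exists_norm_sub_le`).

The size of the perturbation comes from the profile equation, which is nearly linear in the variable
`ξ^(-ν)`. For `0 < σ < 1` with `σ ≤ 1/ν` it yields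
`p = O(α^σ t^(-σ))` and `η^ν / β = 1/(νt) + O(α^σ t^(-1-σ))` (`IsProfile.exists_scaled_bounds`,
`exists_admissible`). If `ν > 1` then `σ = 1/ν` is allowed, which is the exponent in the comparison.
-/

namespace KullAnisimov

/-! ### Linear differential equations: estimates and fundamental solutions -/

section LinearODE

variable {F : Type*} [NormedAddCommGroup F] [NormedSpace ℝ F]

theorem norm_sub_le_of_norm_deriv_le {f f' : ℝ → F} {B B' : ℝ → ℝ} {a b : ℝ} (hab : a ≤ b)
    (hf : ∀ s ∈ Icc a b, HasDerivAt f (f' s) s) (hB : ∀ s ∈ Icc a b, HasDerivAt B (B' s) s)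
    (h : ∀ s ∈ Icc a b, ‖f' s‖ ≤ B' s) : ‖f b - f a‖ ≤ B b - B a := by
  have := image_norm_le_of_norm_deriv_right_le_deriv_boundary' (f := fun s => f s - f a) (f' := f')
    (B := fun s => B s - B a) (B' := B') (a := a) (b := b)
    (fun s hs => ((hf s hs).continuousAt.sub continuousAt_const).continuousWithinAt)
    (fun s hs => ((hf s (Ico_subset_Icc_self hs)).sub_const _).hasDerivWithinAt)
    (by simp)
    (fun s hs => ((hB s hs).continuousAt.sub continuousAt_const).continuousWithinAt)
    (fun s hs => ((hB s (Ico_subset_Icc_self hs)).sub_const _).hasDerivWithinAt)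
    (fun s hs => h s (Ico_subset_Icc_self hs))
  exact this (right_mem_Icc.2 hab)

/-- Two-sided form of the mean value inequality, with a bound depending on the distance to the
base point. -/
theorem norm_le_of_norm_deriv_le_abs {f f' : ℝ → F} {B B' : ℝ → ℝ} {a t : ℝ}
    (hf : ∀ s ∈ uIcc a t, HasDerivAt f (f' s) s) (hfa : f a = 0)
    (hB : ∀ r, HasDerivAt B (B' r) r) (hB0 : B 0 = 0)
    (h : ∀ s ∈ uIcc a t, ‖f' s‖ ≤ B' |s - a|) : ‖f t‖ ≤ B |t - a| := by
  rcases le_total a t with hat | hat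
  · rw [uIcc_of_le hat] at hf h
    have := norm_sub_le_of_norm_deriv_le (B := fun s => B (s - a)) (B' := fun s => B' (s - a)) hat hf
      (fun s _ => (hB (s - a)).comp_sub_const s a)
      (fun s hs => by simpa [abs_of_nonneg (sub_nonneg.2 hs.1)] using h s hs)
    simpa [hfa, hB0, abs_of_nonneg (sub_nonneg.2 hat)] using this
  · rw [uIcc_of_ge hat] at hf h
    have hd : ∀ r ∈ Icc 0 (a - t), a - r ∈ Icc t a := fun r hr =>
      ⟨by linarith [hr.2], by linarith [hr.1]⟩
    have := norm_sub_le_of_norm_deriv_le (f := fun r => f (a - r)) (f' := fun r => -f' (a - r))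
      (B := B) (B' := B') (sub_nonneg.2 hat)
      (fun r hr => (hf (a - r) (hd r hr)).comp_const_sub a r)
      (fun s _ => hB s)
      (fun r hr => by
        have := h (a - r) (hd r hr)
        simpa [abs_of_nonneg hr.1] using this)
    simpa [hfa, hB0, abs_of_nonpos (sub_nonpos.2 hat)] using this

/-- Grönwall's inequality run backwards in time. -/
theorem norm_le_gronwallBound_backward {f f' : ℝ → F} {δ K ε a b : ℝ} (hab : a ≤ b)
    (hf : ∀ s ∈ Icc a b, HasDerivAt f (f' s) s) (hb : ‖f b‖ ≤ δ)
    (h : ∀ s ∈ Icc a b, ‖f' s‖ ≤ K * ‖f s‖ + ε) : ‖f a‖ ≤ gronwallBound δ K ε (b - a) := by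
  have hd : ∀ r ∈ Icc 0 (b - a), b - r ∈ Icc a b := fun r hr =>
    ⟨by linarith [hr.2], by linarith [hr.1]⟩
  have hder : ∀ r ∈ Icc 0 (b - a), HasDerivAt (fun r => f (b - r)) (-f' (b - r)) r := fun r hr =>
    (hf (b - r) (hd r hr)).comp_const_sub b r
  have := norm_le_gronwallBound_of_norm_deriv_right_le (f := fun r => f (b - r))
    (f' := fun r => -f' (b - r)) (δ := δ) (K := K) (ε := ε) (a := 0) (b := b - a)
    (fun r hr => (hder r hr).continuousAt.continuousWithinAt)
    (fun r hr => (hder r (Ico_subset_Icc_self hr)).hasDerivWithinAt) (by simpa using hb)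
    (fun r hr => by simpa using h (b - r) (hd r (Ico_subset_Icc_self hr)))
    (b - a) (right_mem_Icc.2 (sub_nonneg.2 hab))
  simpa using this

/-- A solution of a linear equation on `(a, ∞)` which vanishes from some time on is zero. The
coefficient may be unbounded near `a`. -/
theorem eq_zero_of_linear_of_eventually_eq_zero {f : ℝ → F} {b : ℝ → ℝ} {f' : ℝ → F} {a T : ℝ}
    (hf : ∀ s ∈ Ioi a, HasDerivAt f (f' s) s) (hb : ContinuousOn b (Ioi a))
    (h : ∀ s ∈ Ioi a, ‖f' s‖ ≤ b s * ‖f s‖) (hT : ∀ t, T ≤ t → a < t → f t = 0) :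
    ∀ t ∈ Ioi a, f t = 0 := by
  intro t ht
  rcases le_total T t with h1 | h1
  · exact hT t h1 ht
  have hsub : Icc t T ⊆ Ioi a := fun s hs => lt_of_lt_of_le ht hs.1
  obtain ⟨K, hK⟩ := isCompact_Icc.bddAbove_image (hb.mono hsub)
  have := norm_le_gronwallBound_backward (f := f) (f' := f') (δ := 0) (K := K) (ε := 0) h1
    (fun s hs => hf s (hsub hs)) (by simp [hT T le_rfl (hsub ⟨h1, le_rfl⟩)])
    (fun s hs => by
      have h2 : b s ≤ K := hK ⟨s, hs, rfl⟩
      have := h s (hsub hs)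
      nlinarith [norm_nonneg (f s)])
  rw [gronwallBound_ε0] at this
  simpa using this

/-- Backward variation of constants for a scalar equation `y' = λ y + O(G)` with `λ > 0`. -/
theorem norm_le_of_expanding {y y' : ℝ → ℂ} {r G t S : ℝ} (hr : 0 < r) (hts : t ≤ S)
    (hy : ∀ s ∈ Icc t S, HasDerivAt y (y' s) s) (h : ∀ s ∈ Icc t S, ‖y' s - r * y s‖ ≤ G) :
    ‖y t‖ ≤ G / r + ‖y S‖ * Real.exp (-(r * (S - t))) := by
  have hG : 0 ≤ G := (norm_nonneg _).trans (h t (left_mem_Icc.2 hts))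
  have hE : ∀ s : ℝ, HasDerivAt (fun s : ℝ => ((Real.exp (-(r * s)) : ℝ) : ℂ))
      ((Real.exp (-(r * s)) * -r : ℝ) : ℂ) s := fun s => by
    have : HasDerivAt (fun s : ℝ => Real.exp (-(r * s))) (Real.exp (-(r * s)) * -r) s := by
      simpa using (((hasDerivAt_id s).const_mul r).neg).exp
    exact this.ofReal_comp
  have key := norm_sub_le_of_norm_deriv_le
    (f := fun s => ((Real.exp (-(r * s)) : ℝ) : ℂ) * y s)
    (f' := fun s => ((Real.exp (-(r * s)) : ℝ) : ℂ) * (y' s - r * y s))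
    (B := fun s => -(G / r) * Real.exp (-(r * s))) (B' := fun s => G * Real.exp (-(r * s))) hts
    (fun s hs => by
      refine ((hE s).mul (hy s hs)).congr_deriv ?_
      push_cast
      ring)
    (fun s _ => by
      have : HasDerivAt (fun s : ℝ => Real.exp (-(r * s))) (Real.exp (-(r * s)) * -r) s := by
        simpa using (((hasDerivAt_id s).const_mul r).neg).exp
      refine (this.const_mul (-(G / r))).congr_deriv ?_
      field_simp)
    (fun s hs => by
      rw [norm_mul, Complex.norm_real, Real.norm_of_nonneg (Real.exp_pos _).le, mul_comm]
      exact mul_le_mul_of_nonneg_right (h s hs) (Real.exp_pos _).le)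
  have h1 : ‖((Real.exp (-(r * t)) : ℝ) : ℂ) * y t‖ ≤ G / r * Real.exp (-(r * t))
      + Real.exp (-(r * S)) * ‖y S‖ := by
    have h2 := norm_le_norm_sub_add (((Real.exp (-(r * t)) : ℝ) : ℂ) * y t)
      (((Real.exp (-(r * S)) : ℝ) : ℂ) * y S)
    rw [norm_sub_rev] at h2
    have h3 : ‖((Real.exp (-(r * S)) : ℝ) : ℂ) * y S‖ = Real.exp (-(r * S)) * ‖y S‖ := by
      rw [norm_mul, Complex.norm_real, Real.norm_of_nonneg (Real.exp_pos _).le]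
    have h4 : 0 ≤ G / r * Real.exp (-(r * S)) := by positivity
    rw [h3] at h2
    linarith
  rw [norm_mul, Complex.norm_real, Real.norm_of_nonneg (Real.exp_pos _).le] at h1
  have h5 : Real.exp (-(r * S)) = Real.exp (-(r * t)) * Real.exp (-(r * (S - t))) := by
    rw [← Real.exp_add]
    congr 1
    ring
  rw [h5] at h1
  have h6 := Real.exp_pos (-(r * t))
  refine le_of_mul_le_mul_left ?_ h6
  nlinarith

end LinearODE

section Fundamental

variable {A : Type*} [NormedRing A] [NormedAlgebra ℝ A]

/-- The successive Picard iterates `1, ∫ B, ∫ B ∫ B, …` with base point `a`. -/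
noncomputable def picardTerm (B : ℝ → A) (a : ℝ) : ℕ → ℝ → A
  | 0 => fun _ => 1
  | n + 1 => fun t => ∫ s in a..t, B s * picardTerm B a n s

variable [CompleteSpace A]

theorem hasDerivAt_integral_of_continuousOn_Ioi {F : Type*} [NormedAddCommGroup F]
    [NormedSpace ℝ F] [CompleteSpace F] {f : ℝ → F} {a t : ℝ}
    (hf : ContinuousOn f (Ioi 0)) (ha : 0 < a) (ht : 0 < t) :
    HasDerivAt (fun u => ∫ s in a..u, f s) (f t) t := by
  refine intervalIntegral.integral_hasDerivAt_right ?_ ?_ (hf.continuousAt (Ioi_mem_nhds ht))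
  · refine (hf.mono fun s hs => ?_).intervalIntegrable
    exact lt_of_lt_of_le (lt_min ha ht) hs.1
  · exact hf.stronglyMeasurableAtFilter isOpen_Ioi t ht

theorem continuousOn_picardTerm {B : ℝ → A} (hB : ContinuousOn B (Ioi 0)) {a : ℝ} (ha : 0 < a)
    (n : ℕ) : ContinuousOn (picardTerm B a n) (Ioi 0) := by
  induction n with
  | zero => exact continuousOn_const
  | succ n ih =>
    intro t ht
    exact (hasDerivAt_integral_of_continuousOn_Ioi (hB.mul ih) ha ht).continuousAt.continuousWithinAt

theorem hasDerivAt_picardTerm_succ {B : ℝ → A} (hB : ContinuousOn B (Ioi 0)) {a t : ℝ}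
    (ha : 0 < a) (ht : 0 < t) (n : ℕ) :
    HasDerivAt (picardTerm B a (n + 1)) (B t * picardTerm B a n t) t :=
  hasDerivAt_integral_of_continuousOn_Ioi (hB.mul (continuousOn_picardTerm hB ha n)) ha ht

theorem norm_picardTerm_le {B : ℝ → A} (hB : ContinuousOn B (Ioi 0)) {a K : ℝ} (ha : 0 < a)
    (n : ℕ) (t : ℝ) (ht : 0 < t) (hK : ∀ s ∈ uIcc a t, ‖B s‖ ≤ K) :
    ‖picardTerm B a n t‖ ≤ ‖(1 : A)‖ * (K * |t - a|) ^ n / n.factorial := by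
  have hK0 : 0 ≤ K := (norm_nonneg _).trans (hK a left_mem_uIcc)
  induction n generalizing t with
  | zero => simp [picardTerm]
  | succ n ih =>
    have hpos : ∀ s ∈ uIcc a t, 0 < s := fun s hs => lt_of_lt_of_le (lt_min ha ht) hs.1
    refine norm_le_of_norm_deriv_le_abs (f := picardTerm B a (n + 1))
      (B := fun r => ‖(1 : A)‖ * (K * r) ^ (n + 1) / (n + 1).factorial)
      (B' := fun r => K * (‖(1 : A)‖ * (K * r) ^ n / n.factorial))
      (fun s hs => hasDerivAt_picardTerm_succ hB ha (hpos s hs) n) (by simp [picardTerm])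
      (fun r => ?_) (by simp) (fun s hs => ?_)
    · have h1 : HasDerivAt (fun r : ℝ => (K * r) ^ (n + 1)) (((n + 1 : ℕ) : ℝ) * (K * r) ^ n * K) r := by
        have h := ((hasDerivAt_id r).const_mul K).fun_pow (n + 1)
        simpa using h
      refine ((h1.const_mul ‖(1 : A)‖).div_const _).congr_deriv ?_
      rw [Nat.factorial_succ]
      push_cast
      field_simp
    · refine (norm_mul_le _ _).trans ?_
      refine mul_le_mul (hK s hs) (ih s (hpos s hs) fun u hu => hK u ?_) (norm_nonneg _) hK0
      exact uIcc_subset_uIcc left_mem_uIcc hs hu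

/-- A linear equation with coefficient continuous on `(0, ∞)` has a fundamental solution there:
the Picard series converges, with its derivative, locally uniformly. -/
theorem exists_fundamental {B : ℝ → A} (hB : ContinuousOn B (Ioi 0)) {a : ℝ} (ha : 0 < a) :
    ∃ Φ : ℝ → A, Φ a = 1 ∧ ∀ t ∈ Ioi (0 : ℝ), HasDerivAt Φ (B t * Φ t) t := by
  refine ⟨fun t => ∑' n, picardTerm B a n t, ?_, fun t ht => ?_⟩
  · change ∑' n, picardTerm B a n a = 1
    rw [tsum_eq_single 0]
    · rfl
    · intro n hn
      obtain ⟨m, rfl⟩ := Nat.exists_eq_succ_of_ne_zero hn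
      simp [picardTerm]
  · have ht : 0 < t := ht
    -- a compact interval around `a` and `t` on which all estimates are uniform
    set l := min a t / 2 with hl
    set u := max a t + 1 with hu
    have hl0 : 0 < l := half_pos (lt_min ha ht)
    have hla : l < min a t := half_lt_self (lt_min ha ht)
    have hsub : Icc l u ⊆ Ioi 0 := fun s hs => lt_of_lt_of_le hl0 hs.1
    obtain ⟨K, hK⟩ := isCompact_Icc.bddAbove_image (hB.norm.mono hsub)
    have hK' : ∀ s ∈ Icc l u, ‖B s‖ ≤ K := fun s hs => hK ⟨s, hs, rfl⟩
    have haI : a ∈ Ioo l u := ⟨hla.trans_le (min_le_left _ _), by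
      have := le_max_left a t
      linarith⟩
    have htI : t ∈ Ioo l u := ⟨hla.trans_le (min_le_right _ _), by
      have := le_max_right a t
      linarith⟩
    have hK0 : 0 ≤ K := (norm_nonneg _).trans (hK' a (Ioo_subset_Icc_self haI))
    have hbound : ∀ n, ∀ s ∈ Ioo l u, ‖picardTerm B a n s‖ ≤
        ‖(1 : A)‖ * ((K * (u - l)) ^ n / n.factorial) := by
      intro n s hs
      have h1 := norm_picardTerm_le hB ha n s (hsub (Ioo_subset_Icc_self hs)) (K := K)
        (fun v hv => hK' v ((uIcc_subset_Icc (Ioo_subset_Icc_self haI)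
          (Ioo_subset_Icc_self hs)) hv))
      refine h1.trans ?_
      rw [mul_div_assoc]
      have h2 : |s - a| ≤ u - l := by
        rw [abs_le]
        constructor <;> linarith [hs.1, hs.2, haI.1, haI.2]
      gcongr
    have hder := hasDerivAt_tsum_of_isPreconnected (g := picardTerm B a)
      (g' := fun n s => Nat.casesOn (motive := fun _ => A) n 0 fun m => B s * picardTerm B a m s)
      (u := fun n => Nat.casesOn (motive := fun _ => ℝ) n 0
        fun m => K * (‖(1 : A)‖ * ((K * (u - l)) ^ m / m.factorial)))
      (t := Ioo l u) (y₀ := a) (y := t) ?_ isOpen_Ioo isPreconnected_Ioo ?_ ?_ haI ?_ htI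
    · refine hder.congr_deriv ?_
      rw [Summable.tsum_eq_zero_add]
      · change 0 + ∑' n, B t * picardTerm B a n t = _
        rw [zero_add, Summable.tsum_mul_left]
        refine Summable.of_norm_bounded ((Real.summable_pow_div_factorial _).mul_left _)
          fun n => hbound n t htI
      · rw [← summable_nat_add_iff 1]
        refine Summable.mul_left _ ?_
        refine Summable.of_norm_bounded ((Real.summable_pow_div_factorial _).mul_left _)
          fun n => hbound n t htI
    · rw [← summable_nat_add_iff 1]
      exact ((Real.summable_pow_div_factorial _).mul_left _).mul_left _
    · intro n s hs
      cases n with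
      | zero => exact hasDerivAt_const s 1
      | succ n => exact hasDerivAt_picardTerm_succ hB ha (hsub (Ioo_subset_Icc_self hs)) n
    · intro n s hs
      cases n with
      | zero => simp
      | succ n =>
        exact (norm_mul_le _ _).trans (mul_le_mul (hK' s (Ioo_subset_Icc_self hs))
          (hbound n s hs) (norm_nonneg _) hK0)
    · exact Summable.of_norm_bounded ((Real.summable_pow_div_factorial _).mul_left _)
          fun n => hbound n a haI

end Fundamental

end KullAnisimov

namespace KullAnisimov

/-! ### Perturbations of a diagonal system with a simple slowest mode -/

theorem norm_le_exp_backward {F : Type*} [NormedAddCommGroup F] [NormedSpace ℝ F] {f f' : ℝ → F}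
    {δ K ε a b : ℝ} (hab : a ≤ b) (hK : 0 < K) (hε : 0 ≤ ε)
    (hf : ∀ s ∈ Icc a b, HasDerivAt f (f' s) s) (hb : ‖f b‖ ≤ δ)
    (h : ∀ s ∈ Icc a b, ‖f' s‖ ≤ K * ‖f s‖ + ε) :
    ‖f a‖ ≤ (δ + ε / K) * Real.exp (K * (b - a)) := by
  have := norm_le_gronwallBound_backward hab hf hb h
  rw [gronwallBound_of_K_ne_0 hK.ne'] at this
  have h2 : 0 ≤ ε / K := by positivity
  nlinarith

/-- The constant part `L` of a linear system, diagonalized by the coordinates `y i`, together with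
two perturbation directions: `D`, which enters with a slowly decaying factor `p(t)`, and `G`, which
enters with the factor `1/t`. The eigenvalue `rate i₀ = 0` is simple, with eigenvector `P`, and the
others are at least `1`; `C₀` bounds a vector by its coordinates. The functional `y i₀ + p l` is a left null vector of `L + p D` for every
`p`, and `y i₀ ∘ G` vanishes on `P`; these exact cancellations make the coefficient of the slowest
mode integrable although neither `p(t)` nor `1/t` is. -/
structure SplitData (E ι : Type*) [NormedAddCommGroup E] [NormedSpace ℂ E] where
  y : ι → E →L[ℂ] ℂ
  rate : ι → ℝ
  i₀ : ι
  P : E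
  L : E →L[ℂ] E
  D : E →L[ℂ] E
  G : E →L[ℂ] E
  l : E →L[ℂ] ℂ
  C₀ : ℝ
  C₀_nonneg : 0 ≤ C₀
  y_L : ∀ i v, y i (L v) = rate i * y i v
  one_le_rate : ∀ i, i ≠ i₀ → 1 ≤ rate i
  y_P : y i₀ P = 1
  y_P_ne : ∀ i, i ≠ i₀ → y i P = 0
  left_null : ∀ (p : ℂ) (v : E), y i₀ (L v + p • D v) + p * l (L v + p • D v) = 0
  norm_le : ∀ (v : E) (M : ℝ), (∀ i, ‖y i v‖ ≤ M) → ‖v‖ ≤ C₀ * M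
  y_G_P : y i₀ (G P) = 0

namespace SplitData

variable {E ι : Type*} [NormedAddCommGroup E] [NormedSpace ℂ E]

/-- The operator norm bound in `SplitData.G_le`. -/
noncomputable def C₁ (d : SplitData E ι) : ℝ := ‖d.y d.i₀‖ * ‖d.G‖ * d.C₀

theorem C₁_nonneg (d : SplitData E ι) : 0 ≤ d.C₁ := by
  have := d.C₀_nonneg
  rw [C₁]
  positivity

/-- The slowest coordinate of `G v` is controlled by the fast coordinates of `v`. -/
theorem G_le (d : SplitData E ι) (v : E) {M : ℝ} (hM : 0 ≤ M)
    (h : ∀ i, i ≠ d.i₀ → ‖d.y i v‖ ≤ M) : ‖d.y d.i₀ (d.G v)‖ ≤ d.C₁ * M := by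
  have h1 : ‖v - d.y d.i₀ v • d.P‖ ≤ d.C₀ * M := by
    refine d.norm_le _ _ fun i => ?_
    rw [map_sub, map_smul, smul_eq_mul]
    by_cases hi : i = d.i₀
    · simpa [hi, d.y_P] using hM
    · simpa [d.y_P_ne i hi] using h i hi
  have h2 : d.y d.i₀ (d.G v) = d.y d.i₀ (d.G (v - d.y d.i₀ v • d.P)) := by
    rw [map_sub, map_sub, map_smul, map_smul, d.y_G_P, smul_zero, sub_zero]
  rw [h2, C₁, mul_assoc, mul_assoc]
  exact ((d.y d.i₀).le_opNorm _).trans (mul_le_mul_of_nonneg_left ((d.G.le_opNorm _).trans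
    (mul_le_mul_of_nonneg_left h1 (norm_nonneg _))) (norm_nonneg _))

/-- The generator `L + p(t) D + G/t + R(t)`. -/
noncomputable def gen (d : SplitData E ι) (p : ℝ → ℂ) (R : ℝ → E →L[ℂ] E) (t : ℝ) : E →L[ℂ] E :=
  d.L + p t • d.D + ((1 / t : ℝ) : ℂ) • d.G + R t

/-- On `[T, ∞)` the coefficient `p` is of size `ε t^(-σ)`, its derivative and the remainder `R` are
of size `ε t^(-σ-1)`. -/
structure Admissible (σ ε T : ℝ) (p p' : ℝ → ℂ) (R : ℝ → E →L[ℂ] E) : Prop where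
  hasDerivAt : ∀ t, T ≤ t → HasDerivAt p (p' t) t
  norm_p : ∀ t, T ≤ t → ‖p t‖ ≤ ε * t ^ (-σ)
  norm_p' : ∀ t, T ≤ t → ‖p' t‖ ≤ ε * t ^ (-σ - 1)
  norm_R : ∀ t, T ≤ t → ‖R t‖ ≤ ε * t ^ (-σ - 1)

theorem Admissible.mono {σ ε T T' : ℝ} {p p' : ℝ → ℂ} {R : ℝ → E →L[ℂ] E}
    (h : Admissible σ ε T p p' R) (hT : T ≤ T') : Admissible σ ε T' p p' R :=
  ⟨fun t ht => h.1 t (hT.trans ht), fun t ht => h.2 t (hT.trans ht),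
    fun t ht => h.3 t (hT.trans ht), fun t ht => h.4 t (hT.trans ht)⟩

theorem admissible_zero (σ T : ℝ) :
    Admissible σ 0 T (fun _ => 0) (fun _ => 0) (fun _ => (0 : E →L[ℂ] E)) :=
  ⟨fun t _ => hasDerivAt_const t 0, by simp, by simp, by simp⟩

variable [NormedSpace ℝ E] [IsScalarTower ℝ ℂ E]

theorem hasDerivAt_clm_apply (f : E →L[ℂ] ℂ) {U : ℝ → E} {U' : E} {t : ℝ}
    (h : HasDerivAt U U' t) : HasDerivAt (fun s => f (U s)) (f U') t :=
  (f.restrictScalars ℝ).hasFDerivAt.comp_hasDerivAt t h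

/-- The basic estimate on a bounded interval `[T₁, S]`. The scalar `c` is an approximation of the
slowest coordinate whose derivative is integrable up to the contribution of the fast coordinates,
which are controlled by integrating backwards from `S`. -/
theorem norm_sub_le_of_approx (d : SplitData E ι) {K σ : ℝ} (hK : 0 ≤ K) (hσ : 0 < σ) :
    ∃ T : ℝ, 1 ≤ T ∧ ∃ K' : ℝ, 0 ≤ K' ∧ ∀ (T₁ S e r : ℝ) (U U' : ℝ → E) (c c' : ℝ → ℂ),
      T ≤ T₁ → T₁ ≤ S → 0 ≤ e → 0 ≤ r →
      (∀ t ∈ Icc T₁ S, HasDerivAt U (U' t) t) → (∀ t ∈ Icc T₁ S, HasDerivAt c (c' t) t) →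
      (∀ t ∈ Icc T₁ S, ‖d.y d.i₀ (U t) - c t‖ ≤ (K * ‖U t‖ + e) * t ^ (-σ)) →
      (∀ t ∈ Icc T₁ S, ∀ M, 0 ≤ M → (∀ i, i ≠ d.i₀ → ‖d.y i (U t)‖ ≤ M) →
        ‖c' t‖ ≤ K / t * M + (K * ‖U t‖ + e) * t ^ (-σ - 1)) →
      (∀ t ∈ Icc T₁ S, ∀ i, i ≠ d.i₀ →
        ‖d.y i (U' t) - d.rate i * d.y i (U t)‖ ≤ (K * ‖U t‖ + e) * t ^ (-σ)) →
      (∀ i, i ≠ d.i₀ → ‖d.y i (U S)‖ ≤ r) →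
      ∀ t ∈ Icc T₁ S, ‖U t - c S • d.P‖ ≤ K' * ((‖c S‖ + e + r) * t ^ (-σ) + r) := by
  set K1 : ℝ := 1 + (K + 1) / σ + K with hK1
  have hK1' : 1 ≤ K1 := by
    have : 0 ≤ (K + 1) / σ := by positivity
    linarith
  have hC := d.C₀_nonneg
  set K2 : ℝ := K * (2 * ‖d.P‖ + 2 * (d.C₀ * K1)) + 1 with hK2
  have hlim : Tendsto (fun t : ℝ => d.C₀ * K1 * K * t ^ (-σ)) atTop (𝓝 0) := by
    simpa using (tendsto_rpow_neg_atTop hσ).const_mul (d.C₀ * K1 * K)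
  obtain ⟨T, hT1, hT⟩ := ((eventually_ge_atTop (1 : ℝ)).and
    (hlim.eventually (ge_mem_nhds (by norm_num : (0 : ℝ) < 1 / 2)))).exists
  refine ⟨T, hT1, d.C₀ * K1 * (K2 + 1), by positivity, ?_⟩
  intro T₁ S e r U U' c c' hTT hTS he hr hU hc ha hb hf hrS
  have hpos : ∀ t ∈ Icc T₁ S, 0 < t := fun t ht => by linarith [ht.1]
  obtain ⟨x, hx, hmax⟩ := isCompact_Icc.exists_isMaxOn (nonempty_Icc.2 hTS)
    (f := fun t => ‖U t‖) (fun t ht => ((hU t ht).continuousAt.norm).continuousWithinAt)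
  set m := ‖U x‖ with hm
  have hm0 : 0 ≤ m := norm_nonneg _
  have hle : ∀ t ∈ Icc T₁ S, ‖U t‖ ≤ m := fun t ht => hmax ht
  set M := K * m + e with hM
  have hM0 : 0 ≤ M := by positivity
  have hMle : ∀ t ∈ Icc T₁ S, K * ‖U t‖ + e ≤ M := fun t ht => by
    have := mul_le_mul_of_nonneg_left (hle t ht) hK
    linarith
  -- the fast coordinates
  have hy : ∀ t ∈ Icc T₁ S, ∀ i, i ≠ d.i₀ →
      ‖d.y i (U t)‖ ≤ M * t ^ (-σ) + r * Real.exp (-(S - t)) := by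
    intro t ht i hi
    have hrate := d.one_le_rate i hi
    have hsub : Icc t S ⊆ Icc T₁ S := Icc_subset_Icc_left ht.1
    have hp : (0 : ℝ) ≤ t ^ (-σ) := Real.rpow_nonneg (hpos t ht).le _
    have h1 := norm_le_of_expanding (y := fun s => d.y i (U s)) (y' := fun s => d.y i (U' s))
      (r := d.rate i) (G := M * t ^ (-σ)) (by linarith) ht.2
      (fun s hs => hasDerivAt_clm_apply _ (hU s (hsub hs)))
      (fun s hs => (hf s (hsub hs) i hi).trans <| by
        have h2 : s ^ (-σ) ≤ t ^ (-σ) :=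
          Real.rpow_le_rpow_of_nonpos (hpos t ht) hs.1 (by linarith)
        exact mul_le_mul (hMle s (hsub hs)) h2 (Real.rpow_nonneg (hpos s (hsub hs)).le _) hM0)
    refine h1.trans (add_le_add (div_le_self (by positivity) hrate) ?_)
    refine mul_le_mul (hrS i hi) (Real.exp_le_exp.2 ?_) (Real.exp_pos _).le hr
    nlinarith [ht.2]
  -- the slow coordinate
  have hcS : ∀ t ∈ Icc T₁ S, ‖c S - c t‖ ≤ (K + 1) * M / σ * t ^ (-σ) + K * r := by
    intro t ht
    have hsub : Icc t S ⊆ Icc T₁ S := Icc_subset_Icc_left ht.1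
    have h1 := norm_sub_le_of_norm_deriv_le (f := c) (f' := c')
      (B := fun s => -((K + 1) * M / σ) * s ^ (-σ) + K * r * Real.exp (-(S - s)))
      (B' := fun s => (K + 1) * M * s ^ (-σ - 1) + K * r * Real.exp (-(S - s))) ht.2
      (fun s hs => hc s (hsub hs))
      (fun s hs => by
        have h2 := (Real.hasDerivAt_rpow_const (x := s) (p := -σ)
          (Or.inl (hpos s (hsub hs)).ne')).const_mul (-((K + 1) * M / σ))
        have h3 : HasDerivAt (fun s => Real.exp (-(S - s))) (Real.exp (-(S - s))) s := by
          simpa using (((hasDerivAt_id s).const_sub S).neg).exp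
        refine (h2.add (h3.const_mul (K * r))).congr_deriv ?_
        field_simp)
      (fun s hs => by
        have hs1 : 1 ≤ s := by linarith [(hsub hs).1]
        have hs0 : 0 < s := by linarith
        refine (hb s (hsub hs) _ (by positivity) (hy s (hsub hs))).trans ?_
        have h2 : s ^ (-σ - 1) = s ^ (-σ) / s := by rw [Real.rpow_sub hs0, Real.rpow_one]
        have h3 : K / s * (r * Real.exp (-(S - s))) ≤ K * (r * Real.exp (-(S - s))) :=
          mul_le_mul_of_nonneg_right (div_le_self hK hs1) (by positivity)
        have h4 : (K * ‖U s‖ + e) * s ^ (-σ - 1) ≤ M * s ^ (-σ - 1) :=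
          mul_le_mul_of_nonneg_right (hMle s (hsub hs)) (Real.rpow_nonneg hs0.le _)
        have h5 : K / s * (M * s ^ (-σ)) = K * M * s ^ (-σ - 1) := by
          rw [h2]
          ring
        linarith)
    have hS0 : (0 : ℝ) ≤ S ^ (-σ) := Real.rpow_nonneg ((hpos t ht).le.trans ht.2) _
    have h6 : 0 ≤ (K + 1) * M / σ * S ^ (-σ) := by positivity
    have h7 : 0 ≤ K * r * Real.exp (-(S - t)) := by positivity
    simp only [sub_self, neg_zero, Real.exp_zero] at h1
    linarith
  have hW : ∀ t ∈ Icc T₁ S, ‖U t - c S • d.P‖ ≤ d.C₀ * K1 * (M * t ^ (-σ) + r) := by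
    intro t ht
    have hp : (0 : ℝ) ≤ t ^ (-σ) := Real.rpow_nonneg (hpos t ht).le _
    rw [mul_assoc]
    refine d.norm_le _ _ fun i => ?_
    rw [map_sub, map_smul, smul_eq_mul]
    have hMt : 0 ≤ M * t ^ (-σ) := by positivity
    by_cases hi : i = d.i₀
    · subst hi
      rw [d.y_P, mul_one]
      have h1 := ha t ht
      have h2 := hcS t ht
      have h3 : (K * ‖U t‖ + e) * t ^ (-σ) ≤ M * t ^ (-σ) :=
        mul_le_mul_of_nonneg_right (hMle t ht) hp
      have h4 : ‖d.y d.i₀ (U t) - c S‖ ≤ ‖d.y d.i₀ (U t) - c t‖ + ‖c S - c t‖ := by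
        rw [norm_sub_rev (c S)]
        exact norm_sub_le_norm_sub_add_norm_sub _ _ _
      have h5 : (K + 1) * M / σ * t ^ (-σ) = (K + 1) / σ * (M * t ^ (-σ)) := by ring
      have h6 : 0 ≤ (K + 1) / σ * r := by positivity
      have h7 : 0 ≤ K * (M * t ^ (-σ)) := by positivity
      have h8 : K1 * (M * t ^ (-σ) + r) = M * t ^ (-σ) + r + (K + 1) / σ * (M * t ^ (-σ))
        + (K + 1) / σ * r + K * (M * t ^ (-σ)) + K * r := by
        rw [hK1]
        ring
      linarith
    · rw [d.y_P_ne i hi, mul_zero, sub_zero]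
      have h1 := hy t ht i hi
      have h2 : r * Real.exp (-(S - t)) ≤ r :=
        mul_le_of_le_one_right hr (Real.exp_le_one_iff.2 (by linarith [ht.2]))
      nlinarith
  have hdecay : ∀ t ∈ Icc T₁ S, t ^ (-σ) ≤ T ^ (-σ) := fun t ht =>
    Real.rpow_le_rpow_of_nonpos (by linarith) (hTT.trans ht.1) (by linarith)
  have hT2 : T ^ (-σ) ≤ 1 := Real.rpow_le_one_of_one_le_of_nonpos hT1 (by linarith)
  -- the maximum is absorbed thanks to the choice of `T`
  have hmle : m ≤ 2 * ‖d.P‖ * ‖c S‖ + 2 * (d.C₀ * K1) * (e + r) := by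
    have h1 := hW x hx
    have h2 : m ≤ ‖U x - c S • d.P‖ + ‖c S‖ * ‖d.P‖ := by
      rw [← norm_smul]
      exact norm_le_norm_sub_add _ _
    have h3 : d.C₀ * K1 * (M * x ^ (-σ) + r) ≤ d.C₀ * K1 * (M * T ^ (-σ) + r) := by
      have := hdecay x hx
      gcongr
    have h4 : d.C₀ * K1 * (M * T ^ (-σ) + r)
        = (d.C₀ * K1 * K * T ^ (-σ)) * m + d.C₀ * K1 * e * T ^ (-σ) + d.C₀ * K1 * r := by
      rw [hM]
      ring
    have h5 : (d.C₀ * K1 * K * T ^ (-σ)) * m ≤ 1 / 2 * m := mul_le_mul_of_nonneg_right hT hm0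
    have h6 : d.C₀ * K1 * e * T ^ (-σ) ≤ d.C₀ * K1 * e :=
      mul_le_of_le_one_right (by positivity) hT2
    nlinarith
  have hMle2 : M ≤ K2 * (‖c S‖ + e + r) := by
    have h1 := mul_le_mul_of_nonneg_left hmle hK
    have h2 : 0 ≤ K * (2 * ‖d.P‖) * (e + r) := by positivity
    have h3 : 0 ≤ K * (2 * (d.C₀ * K1)) * ‖c S‖ := by positivity
    have h4 : 0 ≤ ‖c S‖ := norm_nonneg _
    rw [hM, hK2]
    nlinarith
  intro t ht
  refine (hW t ht).trans ?_
  rw [mul_assoc (d.C₀ * K1)]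
  refine mul_le_mul_of_nonneg_left ?_ (by positivity)
  have hp : (0 : ℝ) ≤ t ^ (-σ) := Real.rpow_nonneg (hpos t ht).le _
  have h1 := mul_le_mul_of_nonneg_right hMle2 hp
  have h2 : 0 ≤ (‖c S‖ + e + r) * t ^ (-σ) := by positivity
  have h3 : 0 ≤ K2 * r := by positivity
  nlinarith

set_option maxHeartbeats 1000000 in
/-- Comparison of a solution `V` of the perturbed system with a solution `W` of the unperturbed
one, on a bounded interval. -/
theorem norm_sub_sub_le [Fintype ι] (d : SplitData E ι) {σ ε₀ : ℝ} (hσ : 0 < σ) (hσ1 : σ ≤ 1)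
    (hε₀ : 0 ≤ ε₀) :
    ∃ T : ℝ, 1 ≤ T ∧ ∃ K' : ℝ, 0 ≤ K' ∧ ∀ (T₁ S e r ε : ℝ) (p p' : ℝ → ℂ) (R : ℝ → E →L[ℂ] E)
      (V W : ℝ → E), T ≤ T₁ → T₁ ≤ S → 0 ≤ e → 0 ≤ r → 0 ≤ ε → ε ≤ ε₀ →
      Admissible σ ε T₁ p p' R →
      (∀ t ∈ Icc T₁ S, HasDerivAt V (d.gen p R t (V t)) t) →
      (∀ t ∈ Icc T₁ S, HasDerivAt W (d.gen (fun _ => 0) (fun _ => 0) t (W t)) t) →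
      (∀ t ∈ Icc T₁ S, ε * ‖V t‖ ≤ ε₀ * ‖V t - W t‖ + e) →
      (∀ i, i ≠ d.i₀ → ‖d.y i (V S - W S)‖ ≤ r) →
      ∀ t ∈ Icc T₁ S, ‖V t - W t - (d.y d.i₀ (V S - W S) + p S * d.l (V S)) • d.P‖ ≤
        K' * ((‖d.y d.i₀ (V S - W S) + p S * d.l (V S)‖ + e + r) * t ^ (-σ) + r) := by
  set Y : ℝ := ∑ i, ‖d.y i‖ with hY
  have hYi : ∀ i, ‖d.y i‖ ≤ Y := fun i =>
    Finset.single_le_sum (f := fun i => ‖d.y i‖) (fun _ _ => norm_nonneg _) (Finset.mem_univ i)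
  have hY0 : 0 ≤ Y := Finset.sum_nonneg fun _ _ => norm_nonneg _
  set κ : ℝ := 2 * ‖d.l‖ + Y * (‖d.D‖ + 2) + ‖d.l‖ * (‖d.G‖ + ε₀) with hκ
  have hκ0 : 0 ≤ κ := by positivity
  have hC₁ := d.C₁_nonneg
  obtain ⟨T, hT1, K', hK', H⟩ := d.norm_sub_le_of_approx
    (K := d.C₁ + Y * ‖d.G‖ + κ * ε₀) (by positivity) hσ
  refine ⟨T, hT1, K' * (κ + 1), by positivity, ?_⟩
  intro T₁ S e r ε p p' R V W hT hTS he hr hε hεε hadm hV hW hVW hrS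
  have hnull : ∀ v, d.y d.i₀ (d.L v) = 0 := fun v => by simpa using d.left_null 0 v
  have key := H T₁ S (κ * e) r (fun t => V t - W t)
    (fun t => d.gen p R t (V t) - d.gen (fun _ => 0) (fun _ => 0) t (W t))
    (fun t => d.y d.i₀ (V t - W t) + p t * d.l (V t))
    (fun t => d.y d.i₀ (d.gen p R t (V t) - d.gen (fun _ => 0) (fun _ => 0) t (W t))
      + (p' t * d.l (V t) + p t * d.l (d.gen p R t (V t)))) hT hTS (by positivity) hr
    (fun t ht => (hV t ht).sub (hW t ht))
    (fun t ht => (hasDerivAt_clm_apply _ ((hV t ht).sub (hW t ht))).add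
      ((hadm.1 t ht.1).mul (hasDerivAt_clm_apply _ (hV t ht)))) ?_ ?_ ?_ hrS
  · intro t ht
    have hp : (0 : ℝ) ≤ t ^ (-σ) := Real.rpow_nonneg (by linarith [ht.1]) _
    refine (key t ht).trans ?_
    rw [mul_assoc]
    refine mul_le_mul_of_nonneg_left ?_ hK'
    have h1 : 0 ≤ ‖d.y d.i₀ (V S - W S) + p S * d.l (V S)‖ := norm_nonneg _
    set X := ‖d.y d.i₀ (V S - W S) + p S * d.l (V S)‖
    have h2 : 0 ≤ (κ * X + e + κ * r) * t ^ (-σ) := by positivity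
    have h3 : 0 ≤ κ * r := by positivity
    nlinarith
  · intro t ht
    have hp : (0 : ℝ) ≤ t ^ (-σ) := Real.rpow_nonneg (by linarith [ht.1]) _
    have h1 : ‖d.y d.i₀ (V t - W t) - (d.y d.i₀ (V t - W t) + p t * d.l (V t))‖
        ≤ (‖d.l‖ * (ε * ‖V t‖)) * t ^ (-σ) := by
      rw [sub_add_cancel_left, norm_neg, norm_mul]
      calc ‖p t‖ * ‖d.l (V t)‖ ≤ (ε * t ^ (-σ)) * (‖d.l‖ * ‖V t‖) :=
            mul_le_mul (hadm.2 t ht.1) (d.l.le_opNorm _) (norm_nonneg _) (by positivity)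
        _ = _ := by ring
    refine h1.trans (mul_le_mul_of_nonneg_right ?_ hp)
    have h2 := hVW t ht
    have h3 : ‖d.l‖ ≤ κ := by
      have : 0 ≤ Y * (‖d.D‖ + 2) + ‖d.l‖ * (‖d.G‖ + ε₀) := by positivity
      linarith [norm_nonneg d.l]
    calc ‖d.l‖ * (ε * ‖V t‖) ≤ κ * (ε₀ * ‖V t - W t‖ + e) :=
          mul_le_mul h3 h2 (by positivity) hκ0
      _ ≤ _ := by
        have : 0 ≤ (d.C₁ + Y * ‖d.G‖) * ‖V t - W t‖ := by positivity
        linarith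
  · intro t ht M hM0 hM
    have ht1 : 1 ≤ t := by linarith [ht.1]
    have ht0 : 0 < t := by linarith
    have hp : (0 : ℝ) ≤ t ^ (-σ) := Real.rpow_nonneg ht0.le _
    have hp1 : (0 : ℝ) ≤ t ^ (-σ - 1) := Real.rpow_nonneg ht0.le _
    have hle1 : t ^ (-σ) ≤ 1 := Real.rpow_le_one_of_one_le_of_nonpos ht1 (by linarith)
    have hsplit : t ^ (-σ - 1) = t ^ (-σ) * (1 / t) := by
      rw [Real.rpow_sub ht0, Real.rpow_one]
      ring
    have e1 : d.y d.i₀ (d.gen p R t (V t) - d.gen (fun _ => 0) (fun _ => 0) t (W t))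
        + (p' t * d.l (V t) + p t * d.l (d.gen p R t (V t)))
        = ((1 / t : ℝ) : ℂ) * d.y d.i₀ (d.G (V t - W t)) + (d.y d.i₀ (R t (V t))
          + (p t * (((1 / t : ℝ) : ℂ) * d.l (d.G (V t))) + (p t * d.l (R t (V t))
          + p' t * d.l (V t)))) := by
      have h1 := d.left_null (p t) (V t)
      have h2 := hnull (W t)
      simp only [map_add, map_smul, smul_eq_mul] at h1
      simp only [gen, add_apply, smul_apply,
        zero_apply, map_add, map_sub, map_smul, smul_eq_mul, zero_smul, map_zero]
      linear_combination h1 - h2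
    rw [e1]
    have n1 : ‖((1 / t : ℝ) : ℂ)‖ = 1 / t := by
      rw [Complex.norm_real, Real.norm_of_nonneg (by positivity)]
    have b1 : ‖((1 / t : ℝ) : ℂ) * d.y d.i₀ (d.G (V t - W t))‖ ≤ d.C₁ / t * M := by
      rw [norm_mul, n1]
      calc 1 / t * ‖d.y d.i₀ (d.G (V t - W t))‖ ≤ 1 / t * (d.C₁ * M) :=
            mul_le_mul_of_nonneg_left (d.G_le _ hM0 hM) (by positivity)
        _ = _ := by ring
    have b2 : ‖d.y d.i₀ (R t (V t))‖ ≤ Y * (ε * ‖V t‖) * t ^ (-σ - 1) := by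
      calc ‖d.y d.i₀ (R t (V t))‖ ≤ Y * ((ε * t ^ (-σ - 1)) * ‖V t‖) :=
            ((d.y d.i₀).le_opNorm _).trans (mul_le_mul (hYi _) (((R t).le_opNorm _).trans
              (mul_le_mul_of_nonneg_right (hadm.4 t ht.1) (norm_nonneg _))) (norm_nonneg _) hY0)
        _ = _ := by ring
    have b3 : ‖p t * (((1 / t : ℝ) : ℂ) * d.l (d.G (V t)))‖
        ≤ ‖d.l‖ * ‖d.G‖ * (ε * ‖V t‖) * t ^ (-σ - 1) := by
      rw [norm_mul, norm_mul, n1]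
      calc ‖p t‖ * (1 / t * ‖d.l (d.G (V t))‖)
          ≤ (ε * t ^ (-σ)) * (1 / t * (‖d.l‖ * (‖d.G‖ * ‖V t‖))) := by
            refine mul_le_mul (hadm.2 t ht.1) ?_ (by positivity) (by positivity)
            refine mul_le_mul_of_nonneg_left ?_ (by positivity)
            exact (d.l.le_opNorm _).trans
              (mul_le_mul_of_nonneg_left (d.G.le_opNorm _) (norm_nonneg _))
        _ = _ := by
            rw [hsplit]
            ring
    have b4 : ‖p t * d.l (R t (V t))‖ ≤ ‖d.l‖ * ε₀ * (ε * ‖V t‖) * t ^ (-σ - 1) := by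
      rw [norm_mul]
      have hpε : ‖p t‖ ≤ ε₀ := (hadm.2 t ht.1).trans
        ((mul_le_of_le_one_right hε hle1).trans hεε)
      calc ‖p t‖ * ‖d.l (R t (V t))‖ ≤ ε₀ * (‖d.l‖ * ((ε * t ^ (-σ - 1)) * ‖V t‖)) := by
            refine mul_le_mul hpε ?_ (norm_nonneg _) hε₀
            exact (d.l.le_opNorm _).trans (mul_le_mul_of_nonneg_left (((R t).le_opNorm _).trans
              (mul_le_mul_of_nonneg_right (hadm.4 t ht.1) (norm_nonneg _))) (norm_nonneg _))
        _ = _ := by ring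
    have b5 : ‖p' t * d.l (V t)‖ ≤ ‖d.l‖ * (ε * ‖V t‖) * t ^ (-σ - 1) := by
      rw [norm_mul]
      calc ‖p' t‖ * ‖d.l (V t)‖ ≤ (ε * t ^ (-σ - 1)) * (‖d.l‖ * ‖V t‖) :=
            mul_le_mul (hadm.3 t ht.1) (d.l.le_opNorm _) (norm_nonneg _) (by positivity)
        _ = _ := by ring
    have hsum := (norm_add_le_of_le b1 (norm_add_le_of_le b2 (norm_add_le_of_le b3
      (norm_add_le_of_le b4 b5))))
    refine hsum.trans ?_
    have h2 := hVW t ht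
    have hεV : 0 ≤ ε * ‖V t‖ := by positivity
    have h3 : Y * (ε * ‖V t‖) + (‖d.l‖ * ‖d.G‖ * (ε * ‖V t‖) + (‖d.l‖ * ε₀ * (ε * ‖V t‖)
        + ‖d.l‖ * (ε * ‖V t‖))) ≤ κ * (ε₀ * ‖V t - W t‖ + e) := by
      refine le_trans ?_ (mul_le_mul_of_nonneg_left h2 hκ0)
      have : 0 ≤ (‖d.l‖ + Y * (‖d.D‖ + 1)) * (ε * ‖V t‖) := by positivity
      rw [hκ]
      linarith
    have h4 := mul_le_mul_of_nonneg_right h3 hp1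
    have h5 : 0 ≤ (d.C₁ + Y * ‖d.G‖) * ‖V t - W t‖ * t ^ (-σ - 1) := by positivity
    have h6 : d.C₁ / t * M ≤ (d.C₁ + Y * ‖d.G‖ + κ * ε₀) / t * M := by
      have : 0 ≤ Y * ‖d.G‖ + κ * ε₀ := by positivity
      gcongr
      linarith
    linarith
  · intro t ht i hi
    have ht1 : 1 ≤ t := by linarith [ht.1]
    have ht0 : 0 < t := by linarith
    have hp : (0 : ℝ) ≤ t ^ (-σ) := Real.rpow_nonneg ht0.le _
    have hinv : 1 / t ≤ t ^ (-σ) := by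
      rw [one_div, ← Real.rpow_neg_one]
      exact Real.rpow_le_rpow_of_exponent_le ht1 (by linarith)
    have hsplit : t ^ (-σ - 1) ≤ t ^ (-σ) :=
      Real.rpow_le_rpow_of_exponent_le ht1 (by linarith)
    have e1 : d.y i (d.gen p R t (V t) - d.gen (fun _ => 0) (fun _ => 0) t (W t))
        - d.rate i * d.y i (V t - W t)
        = p t * d.y i (d.D (V t)) + (((1 / t : ℝ) : ℂ) * d.y i (d.G (V t - W t))
          + d.y i (R t (V t))) := by
      have h1 := d.y_L i (V t)
      have h2 := d.y_L i (W t)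
      simp only [gen, add_apply, smul_apply,
        zero_apply, map_add, map_sub, map_smul, smul_eq_mul, zero_smul, map_zero]
      linear_combination h1 - h2
    rw [e1]
    have n1 : ‖((1 / t : ℝ) : ℂ)‖ = 1 / t := by
      rw [Complex.norm_real, Real.norm_of_nonneg (by positivity)]
    have b1 : ‖p t * d.y i (d.D (V t))‖ ≤ Y * ‖d.D‖ * (ε * ‖V t‖) * t ^ (-σ) := by
      rw [norm_mul]
      calc ‖p t‖ * ‖d.y i (d.D (V t))‖ ≤ (ε * t ^ (-σ)) * (Y * (‖d.D‖ * ‖V t‖)) := by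
            refine mul_le_mul (hadm.2 t ht.1) ?_ (norm_nonneg _) (by positivity)
            exact ((d.y i).le_opNorm _).trans
              (mul_le_mul (hYi i) (d.D.le_opNorm _) (norm_nonneg _) hY0)
        _ = _ := by ring
    have b2 : ‖((1 / t : ℝ) : ℂ) * d.y i (d.G (V t - W t))‖
        ≤ Y * ‖d.G‖ * ‖V t - W t‖ * t ^ (-σ) := by
      rw [norm_mul, n1]
      calc 1 / t * ‖d.y i (d.G (V t - W t))‖ ≤ t ^ (-σ) * (Y * (‖d.G‖ * ‖V t - W t‖)) := by
            refine mul_le_mul hinv ?_ (norm_nonneg _) hp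
            exact ((d.y i).le_opNorm _).trans
              (mul_le_mul (hYi i) (d.G.le_opNorm _) (norm_nonneg _) hY0)
        _ = _ := by ring
    have b3 : ‖d.y i (R t (V t))‖ ≤ Y * (ε * ‖V t‖) * t ^ (-σ) := by
      calc ‖d.y i (R t (V t))‖ ≤ Y * ((ε * t ^ (-σ)) * ‖V t‖) := by
            refine ((d.y i).le_opNorm _).trans (mul_le_mul (hYi _) (((R t).le_opNorm _).trans
              (mul_le_mul_of_nonneg_right ((hadm.4 t ht.1).trans ?_) (norm_nonneg _)))
              (norm_nonneg _) hY0)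
            exact mul_le_mul_of_nonneg_left hsplit hε
        _ = _ := by ring
    refine (norm_add_le_of_le b1 (norm_add_le_of_le b2 b3)).trans ?_
    have h2 := hVW t ht
    have h3 : Y * ‖d.D‖ * (ε * ‖V t‖) + Y * (ε * ‖V t‖) ≤ κ * (ε₀ * ‖V t - W t‖ + e) := by
      refine le_trans ?_ (mul_le_mul_of_nonneg_left h2 hκ0)
      have : 0 ≤ (2 * ‖d.l‖ + Y + ‖d.l‖ * (‖d.G‖ + ε₀)) * (ε * ‖V t‖) := by positivity
      rw [hκ]
      linarith
    have h4 := mul_le_mul_of_nonneg_right h3 hp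
    have h5 : 0 ≤ d.C₁ * ‖V t - W t‖ * t ^ (-σ) := by positivity
    linarith

end SplitData
end KullAnisimov

namespace KullAnisimov

/-! ### Existence, uniqueness and comparison of normalized solutions -/

namespace SplitData

variable {E ι : Type*} [NormedAddCommGroup E] [NormedSpace ℂ E]

theorem norm_gen_le (d : SplitData E ι) {σ ε ε₀ t₀ t : ℝ} (hσ : 0 < σ) (ht₀ : 0 < t₀)
    (hε : 0 ≤ ε) (hεε : ε ≤ ε₀) {p p' : ℝ → ℂ} {R : ℝ → E →L[ℂ] E}
    (hadm : Admissible σ ε t₀ p p' R) (ht : t₀ ≤ t) :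
    ‖d.gen p R t‖ ≤ ‖d.L‖ + ε₀ * t₀ ^ (-σ) * ‖d.D‖ + 1 / t₀ * ‖d.G‖ + ε₀ * t₀ ^ (-σ - 1) := by
  have ht' : 0 < t := ht₀.trans_le ht
  have hε₀ : 0 ≤ ε₀ := hε.trans hεε
  have h1 : t ^ (-σ) ≤ t₀ ^ (-σ) := Real.rpow_le_rpow_of_nonpos ht₀ ht (by linarith)
  have h2 : t ^ (-σ - 1) ≤ t₀ ^ (-σ - 1) := Real.rpow_le_rpow_of_nonpos ht₀ ht (by linarith)
  refine norm_add_le_of_le (norm_add_le_of_le (norm_add_le_of_le le_rfl ?_) ?_) ?_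
  · rw [norm_smul]
    refine mul_le_mul_of_nonneg_right ((hadm.2 t ht).trans ?_) (norm_nonneg _)
    exact mul_le_mul hεε h1 (Real.rpow_nonneg ht'.le _) hε₀
  · rw [norm_smul, Complex.norm_real, Real.norm_of_nonneg (by positivity)]
    exact mul_le_mul_of_nonneg_right (one_div_le_one_div_of_le ht₀ ht) (norm_nonneg _)
  · exact (hadm.4 t ht).trans (mul_le_mul hεε h2 (Real.rpow_nonneg ht'.le _) hε₀)

variable [NormedSpace ℝ E]

theorem hasDerivAt_gen_zero (d : SplitData E ι) (p : ℝ → ℂ) (R : ℝ → E →L[ℂ] E) (t : ℝ) :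
    HasDerivAt (fun _ => (0 : E)) (d.gen p R t 0) t := by
  rw [map_zero]
  exact hasDerivAt_const t 0

variable [IsScalarTower ℝ ℂ E] [Fintype ι]

/-- If `V - W` converges, it converges to a multiple of `P` at the rate `t^(-σ)`. -/
theorem norm_sub_le_of_tendsto (d : SplitData E ι) {σ ε₀ : ℝ} (hσ : 0 < σ) (hσ1 : σ ≤ 1)
    (hε₀ : 0 ≤ ε₀) :
    ∃ T : ℝ, 1 ≤ T ∧ ∃ K' : ℝ, 0 ≤ K' ∧ ∀ (T₁ e ε : ℝ) (p p' : ℝ → ℂ) (R : ℝ → E →L[ℂ] E)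
      (V W : ℝ → E) (v : ℂ) (w : E), T ≤ T₁ → 0 ≤ e → 0 ≤ ε → ε ≤ ε₀ →
      Admissible σ ε T₁ p p' R →
      (∀ t, T₁ ≤ t → HasDerivAt V (d.gen p R t (V t)) t) →
      (∀ t, T₁ ≤ t → HasDerivAt W (d.gen (fun _ => 0) (fun _ => 0) t (W t)) t) →
      (∀ t, T₁ ≤ t → ε * ‖V t‖ ≤ ε₀ * ‖V t - W t‖ + e) →
      Tendsto V atTop (𝓝 w) → Tendsto (fun t => V t - W t) atTop (𝓝 (v • d.P)) →
      ∀ t, T₁ ≤ t → ‖V t - W t - v • d.P‖ ≤ K' * ((‖v‖ + e) * t ^ (-σ)) := by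
  classical
  obtain ⟨T, hT1, K', hK', H⟩ := d.norm_sub_sub_le hσ hσ1 hε₀
  refine ⟨T, hT1, K', hK', ?_⟩
  intro T₁ e ε p p' R V W v w hT he hε hεε hadm hV hW hVW hVw hVWv t ht
  set r : ℝ → ℝ := fun S => ∑ i ∈ Finset.univ.erase d.i₀, ‖d.y i (V S - W S)‖ with hr
  set c : ℝ → ℂ := fun S => d.y d.i₀ (V S - W S) + p S * d.l (V S) with hc
  have hr0 : Tendsto r atTop (𝓝 0) := by
    have : Tendsto r atTop (𝓝 (∑ i ∈ Finset.univ.erase d.i₀, ‖d.y i (v • d.P)‖)) :=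
      tendsto_finsetSum _ fun i _ => (((d.y i).continuous.tendsto _).comp hVWv).norm
    refine this.trans (le_of_eq ?_)
    congr 1
    refine Finset.sum_eq_zero fun i hi => ?_
    rw [map_smul, d.y_P_ne i (Finset.ne_of_mem_erase hi), smul_zero, norm_zero]
  have hp0 : Tendsto p atTop (𝓝 0) := by
    have h1 : Tendsto (fun t : ℝ => ε * t ^ (-σ)) atTop (𝓝 0) := by
      simpa using (tendsto_rpow_neg_atTop hσ).const_mul ε
    refine squeeze_zero_norm' ?_ h1
    filter_upwards [eventually_ge_atTop T₁] with s hs using hadm.2 s hs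
  have hcv : Tendsto c atTop (𝓝 v) := by
    have h1 := (((d.y d.i₀).continuous.tendsto _).comp hVWv).add
      (hp0.mul ((d.l.continuous.tendsto _).comp hVw))
    rw [map_smul, d.y_P, smul_eq_mul, mul_one, zero_mul, add_zero] at h1
    exact h1
  have hlhs : Tendsto (fun S => ‖V t - W t - c S • d.P‖) atTop (𝓝 ‖V t - W t - v • d.P‖) :=
    (tendsto_const_nhds.sub (hcv.smul_const _)).norm
  have hrhs : Tendsto (fun S => K' * ((‖c S‖ + e + r S) * t ^ (-σ) + r S)) atTop
      (𝓝 (K' * ((‖v‖ + e + 0) * t ^ (-σ) + 0))) :=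
    ((((hcv.norm.add_const e).add hr0).mul_const _).add hr0).const_mul K'
  rw [add_zero, add_zero] at hrhs
  refine le_of_tendsto_of_tendsto hlhs hrhs ?_
  filter_upwards [eventually_ge_atTop t] with S hS
  refine H T₁ S e (r S) ε p p' R V W hT (ht.trans hS) he
    (Finset.sum_nonneg fun _ _ => norm_nonneg _) hε hεε hadm (fun s hs => hV s hs.1)
    (fun s hs => hW s hs.1) (fun s hs => hVW s hs.1) (fun i hi => ?_) t ⟨ht, hS⟩
  exact Finset.single_le_sum (f := fun i => ‖d.y i (V S - W S)‖) (fun _ _ => norm_nonneg _)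
    (Finset.mem_erase.2 ⟨hi, Finset.mem_univ i⟩)

/-- A solution tending to `P`, obtained by compactness as a limit of the solutions equal to `P` at
the times `S → ∞`. -/
theorem exists_tendsto [FiniteDimensional ℝ E] (d : SplitData E ι) {σ ε T₀ : ℝ} (hσ : 0 < σ)
    (hσ1 : σ ≤ 1) (hε : 0 ≤ ε) {p p' : ℝ → ℂ} {R : ℝ → E →L[ℂ] E}
    (hadm : Admissible σ ε T₀ p p' R) (hcont : ContinuousOn (d.gen p R) (Ioi 0)) :
    ∃ V : ℝ → E, (∀ t ∈ Ioi (0 : ℝ), HasDerivAt V (d.gen p R t (V t)) t) ∧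
      Tendsto V atTop (𝓝 d.P) := by
  have : CompleteSpace E := FiniteDimensional.complete ℝ E
  have : ProperSpace E := FiniteDimensional.proper ℝ E
  obtain ⟨T, hT1, K', hK', H⟩ := d.norm_sub_sub_le hσ hσ1 hε
  set T₁ := max T T₀ with hT₁
  have hTT : T ≤ T₁ := le_max_left _ _
  have hT₁0 : 0 < T₁ := by linarith
  have hadm₁ : Admissible σ ε T₁ p p' R := hadm.mono (le_max_right _ _)
  have hB : ContinuousOn (fun t => (d.gen p R t).restrictScalars ℝ) (Ioi 0) :=
    (ContinuousLinearMap.restrictScalarsL ℂ E E ℝ ℝ).continuous.comp_continuousOn hcont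
  obtain ⟨Φ, hΦ1, hΦ⟩ := exists_fundamental hB hT₁0
  have hsol : ∀ v : E, ∀ t ∈ Ioi (0 : ℝ), HasDerivAt (fun s => Φ s v) (d.gen p R t (Φ t v)) t :=
    fun v t ht => by
      simpa using (hΦ t ht).clm_apply (hasDerivAt_const t v)
  have hsurj : ∀ S, T₁ ≤ S → ∃ v, Φ S v = d.P := by
    intro S hS
    have hinj : Function.Injective (Φ S : E →ₗ[ℝ] E) := by
      rw [← LinearMap.ker_eq_bot, LinearMap.ker_eq_bot']
      intro v hv
      -- a solution vanishing at `S` vanishes at `T₁`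
      have hsub : Icc T₁ S ⊆ Ioi 0 := fun s hs => lt_of_lt_of_le hT₁0 hs.1
      obtain ⟨k, hk⟩ := isCompact_Icc.bddAbove_image (hcont.norm.mono hsub)
      have h := norm_le_gronwallBound_backward (f := fun s => Φ s v) (δ := 0) (K := k) (ε := 0) hS
        (fun s hs => hsol v s (hsub hs)) (by
          have : Φ S v = 0 := hv
          simp [this])
        (fun s hs => by
          have h2 : ‖d.gen p R s‖ ≤ k := hk ⟨s, hs, rfl⟩
          rw [add_zero]
          exact ((d.gen p R s).le_opNorm _).trans
            (mul_le_mul_of_nonneg_right h2 (norm_nonneg _)))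
      rw [gronwallBound_ε0] at h
      simpa [hΦ1] using h
    exact LinearMap.surjective_of_injective hinj d.P
  choose! v hv using hsurj
  set c : ℝ → ℂ := fun S => 1 + p S * d.l d.P with hc
  have key : ∀ S, T₁ ≤ S → ∀ t ∈ Icc T₁ S,
      ‖Φ t (v S) - c S • d.P‖ ≤ K' * (‖c S‖ * t ^ (-σ)) := by
    intro S hS t ht
    have h := H T₁ S 0 0 ε p p' R (fun s => Φ s (v S)) (fun _ => 0) hTT hS le_rfl le_rfl hε
      le_rfl hadm₁ (fun s hs => hsol _ s (lt_of_lt_of_le hT₁0 hs.1))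
      (fun s _ => d.hasDerivAt_gen_zero _ _ s) (fun s _ => by simp)
      (fun i hi => by simp [hv S hS, d.y_P_ne i hi]) t ht
    simpa [hv S hS, d.y_P, hc] using h
  have hp0 : Tendsto p atTop (𝓝 0) := by
    have h1 : Tendsto (fun t : ℝ => ε * t ^ (-σ)) atTop (𝓝 0) := by
      simpa using (tendsto_rpow_neg_atTop hσ).const_mul ε
    refine squeeze_zero_norm' ?_ h1
    filter_upwards [eventually_ge_atTop T₁] with s hs using hadm₁.2 s hs
  have hc1 : Tendsto c atTop (𝓝 1) := by
    simpa using (hp0.mul_const (d.l d.P)).const_add 1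
  have hseq : Tendsto (fun n : ℕ => T₁ + n) atTop atTop :=
    tendsto_atTop_add_const_left _ _ tendsto_natCast_atTop_atTop
  have hcn := hc1.comp hseq
  obtain ⟨M, hM⟩ := (hcn.norm).bddAbove_range
  have hMn : ∀ n : ℕ, ‖c (T₁ + n)‖ ≤ M := fun n => hM ⟨n, rfl⟩
  have hbdd : ∀ n : ℕ, v (T₁ + n) ∈ Metric.closedBall (0 : E) (K' * (M * T₁ ^ (-σ)) + M * ‖d.P‖) := by
    intro n
    have hn : T₁ ≤ T₁ + n := le_add_of_nonneg_right (Nat.cast_nonneg n)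
    have h1 := key (T₁ + n) hn T₁ ⟨le_rfl, hn⟩
    rw [hΦ1] at h1
    rw [mem_closedBall_zero_iff]
    refine (norm_le_norm_sub_add _ (c (T₁ + n) • d.P)).trans (add_le_add (h1.trans ?_) ?_)
    · have h2 : (0 : ℝ) ≤ T₁ ^ (-σ) := Real.rpow_nonneg hT₁0.le _
      exact mul_le_mul_of_nonneg_left (mul_le_mul_of_nonneg_right (hMn n) h2) hK'
    · rw [norm_smul]
      exact mul_le_mul_of_nonneg_right (hMn n) (norm_nonneg _)
  obtain ⟨v₀, -, φ, hφ, hlim⟩ := (isCompact_closedBall (0 : E) _).tendsto_subseq hbdd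
  refine ⟨fun t => Φ t v₀, hsol v₀, ?_⟩
  have hbound : ∀ t, T₁ ≤ t → ‖Φ t v₀ - d.P‖ ≤ K' * (1 * t ^ (-σ)) := by
    intro t ht
    have hcφ := hcn.comp hφ.tendsto_atTop
    have h1 : Tendsto (fun n => ‖Φ t (v (T₁ + φ n)) - c (T₁ + φ n) • d.P‖) atTop
        (𝓝 ‖Φ t v₀ - (1 : ℂ) • d.P‖) :=
      ((((Φ t).continuous.tendsto _).comp hlim).sub (hcφ.smul_const _)).norm
    have h2 : Tendsto (fun n => K' * (‖c (T₁ + φ n)‖ * t ^ (-σ))) atTop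
        (𝓝 (K' * (‖(1 : ℂ)‖ * t ^ (-σ)))) := (hcφ.norm.mul_const _).const_mul _
    rw [one_smul] at h1
    rw [norm_one] at h2
    refine le_of_tendsto_of_tendsto h1 h2 ?_
    filter_upwards [(hseq.comp hφ.tendsto_atTop).eventually_ge_atTop t] with n hn
    exact key _ (ht.trans hn) t ⟨ht, hn⟩
  rw [tendsto_iff_norm_sub_tendsto_zero]
  have h0 : Tendsto (fun t : ℝ => K' * (1 * t ^ (-σ))) atTop (𝓝 0) := by
    simpa using ((tendsto_rpow_neg_atTop hσ).const_mul 1).const_mul K'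
  refine squeeze_zero' (Eventually.of_forall fun _ => norm_nonneg _) ?_ h0
  filter_upwards [eventually_ge_atTop T₁] with t ht using hbound t ht

/-- A solution is determined by its limit. -/
theorem eqOn_of_tendsto (d : SplitData E ι) {σ ε T₀ a : ℝ} (hσ : 0 < σ)
    (hσ1 : σ ≤ 1) (hε : 0 ≤ ε) (ha : 0 ≤ a) {p p' : ℝ → ℂ} {R : ℝ → E →L[ℂ] E}
    (hadm : Admissible σ ε T₀ p p' R) (hcont : ContinuousOn (d.gen p R) (Ioi 0)) {V W : ℝ → E}
    (hV : ∀ t ∈ Ioi a, HasDerivAt V (d.gen p R t (V t)) t)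
    (hW : ∀ t ∈ Ioi a, HasDerivAt W (d.gen p R t (W t)) t)
    (hVl : Tendsto V atTop (𝓝 d.P)) (hWl : Tendsto W atTop (𝓝 d.P)) : EqOn V W (Ioi a) := by
  obtain ⟨T, hT1, K', hK', H⟩ := d.norm_sub_le_of_tendsto hσ hσ1 hε
  have hlim : Tendsto (fun t => V t - W t) atTop (𝓝 0) := by simpa using hVl.sub hWl
  have hU : ∀ t ∈ Ioi a, HasDerivAt (fun t => V t - W t) (d.gen p R t (V t - W t)) t :=
    fun t ht => by
      rw [map_sub]
      exact (hV t ht).sub (hW t ht)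
  set T₁ := max (max T T₀) (a + 1) with hT₁
  have hTT : T ≤ T₁ := (le_max_left _ _).trans (le_max_left _ _)
  have haT : a < T₁ := by
    have := le_max_right (max T T₀) (a + 1)
    linarith
  have hzero := H T₁ 0 ε p p' R (fun t => V t - W t) (fun _ => 0) 0 0 hTT le_rfl hε le_rfl
    (hadm.mono ((le_max_right _ _).trans (le_max_left _ _)))
    (fun t ht => hU t (haT.trans_le ht)) (fun s _ => d.hasDerivAt_gen_zero _ _ s)
    (fun s _ => by simp) hlim (by simpa using hlim)
  have hzero' : ∀ t, T₁ ≤ t → V t - W t = 0 := fun t ht => by simpa using hzero t ht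
  intro t ht
  refine sub_eq_zero.1 (eq_zero_of_linear_of_eventually_eq_zero (b := fun t => ‖d.gen p R t‖)
    hU (hcont.norm.mono (Ioi_subset_Ioi ha)) (fun s _ => (d.gen p R s).le_opNorm _)
    (fun s hs _ => hzero' s hs) t ht)

/-- Normalized solutions are bounded on `[t₀, ∞)`, uniformly in the perturbation. -/
theorem exists_norm_le (d : SplitData E ι) {σ ε₀ t₀ : ℝ} (hσ : 0 < σ) (hσ1 : σ ≤ 1)
    (hε₀ : 0 ≤ ε₀) (ht₀ : 0 < t₀) :
    ∃ C : ℝ, 0 < C ∧ ∀ (ε : ℝ) (p p' : ℝ → ℂ) (R : ℝ → E →L[ℂ] E) (V : ℝ → E), 0 ≤ ε → ε ≤ ε₀ →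
      Admissible σ ε t₀ p p' R → (∀ t ∈ Ioi (0 : ℝ), HasDerivAt V (d.gen p R t (V t)) t) →
      Tendsto V atTop (𝓝 d.P) → ∀ t, t₀ ≤ t → ‖V t‖ ≤ C := by
  obtain ⟨T, hT1, K', hK', H⟩ := d.norm_sub_le_of_tendsto hσ hσ1 hε₀
  set T₁ := max T t₀ with hT₁
  set k := ‖d.L‖ + ε₀ * t₀ ^ (-σ) * ‖d.D‖ + 1 / t₀ * ‖d.G‖ + ε₀ * t₀ ^ (-σ - 1) + 1 with hk
  have hk0 : 0 < k := by positivity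
  set C := (K' + ‖d.P‖ + 1) * Real.exp (k * T₁) with hC
  have hT₁0 : 0 < T₁ := ht₀.trans_le (le_max_right _ _)
  have hCge : K' + ‖d.P‖ + 1 ≤ C := le_mul_of_one_le_right (by positivity)
    (Real.one_le_exp (by positivity))
  refine ⟨C, by positivity, ?_⟩
  intro ε p p' R V hε hεε hadm hV hVl
  have hfar : ∀ t, T₁ ≤ t → ‖V t‖ ≤ K' + ‖d.P‖ + 1 := by
    intro t ht
    have ht1 : 1 ≤ t := by linarith [le_max_left T t₀]
    have h := H T₁ 0 ε p p' R V (fun _ => 0) 1 d.P (le_max_left _ _) le_rfl hε hεε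
      (hadm.mono (le_max_right _ _)) (fun s hs => hV s (hT₁0.trans_le hs))
      (fun s _ => d.hasDerivAt_gen_zero _ _ s)
      (fun s _ => by simpa using mul_le_mul_of_nonneg_right hεε (norm_nonneg _)) hVl
      (by simpa using hVl) t ht
    rw [sub_zero, one_smul, norm_one, add_zero, one_mul] at h
    have h2 : t ^ (-σ) ≤ 1 := Real.rpow_le_one_of_one_le_of_nonpos ht1 (by linarith)
    have h3 := norm_le_norm_sub_add (V t) d.P
    nlinarith
  intro t ht
  rcases le_total T₁ t with h | h
  · exact (hfar t h).trans hCge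
  · have h1 := norm_le_exp_backward (f := V) (δ := K' + ‖d.P‖ + 1) (K := k) (ε := 0) h hk0 le_rfl
      (fun s hs => hV s (ht₀.trans_le (ht.trans hs.1))) (hfar T₁ le_rfl) (fun s hs => by
        rw [add_zero]
        refine ((d.gen p R s).le_opNorm _).trans (mul_le_mul_of_nonneg_right ?_ (norm_nonneg _))
        exact (d.norm_gen_le hσ ht₀ hε hεε hadm (ht.trans hs.1)).trans (by linarith))
    rw [zero_div, add_zero] at h1
    refine h1.trans (mul_le_mul_of_nonneg_left (Real.exp_le_exp.2 ?_) (by positivity))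
    exact mul_le_mul_of_nonneg_left (by linarith) hk0.le

/-- The normalized solutions of the perturbed and of the unperturbed system differ by a quantity
of the size of the perturbation, uniformly on `[t₀, ∞)`. -/
theorem exists_norm_sub_le (d : SplitData E ι) {σ ε₀ t₀ : ℝ} (hσ : 0 < σ) (hσ1 : σ ≤ 1)
    (hε₀ : 0 ≤ ε₀) (ht₀ : 0 < t₀) :
    ∃ C : ℝ, 0 < C ∧ ∀ (ε : ℝ) (p p' : ℝ → ℂ) (R : ℝ → E →L[ℂ] E) (V W : ℝ → E),
      0 ≤ ε → ε ≤ ε₀ → Admissible σ ε t₀ p p' R →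
      (∀ t ∈ Ioi (0 : ℝ), HasDerivAt V (d.gen p R t (V t)) t) →
      (∀ t ∈ Ioi (0 : ℝ), HasDerivAt W (d.gen (fun _ => 0) (fun _ => 0) t (W t)) t) →
      Tendsto V atTop (𝓝 d.P) → Tendsto W atTop (𝓝 d.P) →
      ∀ t, t₀ ≤ t → ‖V t - W t‖ ≤ C * ε := by
  obtain ⟨T, hT1, K', hK', H⟩ := d.norm_sub_le_of_tendsto hσ hσ1 hε₀
  obtain ⟨M, hM0, hM⟩ := d.exists_norm_le hσ hσ1 hε₀ ht₀
  set T₁ := max T t₀ with hT₁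
  set k := ‖d.L‖ + ε₀ * t₀ ^ (-σ) * ‖d.D‖ + 1 / t₀ * ‖d.G‖ + ε₀ * t₀ ^ (-σ - 1) + 1 with hk
  have hk0 : 0 < k := by positivity
  set b := (t₀ ^ (-σ) * ‖d.D‖ + t₀ ^ (-σ - 1)) * M with hb
  have hb0 : 0 ≤ b := by positivity
  have hT₁0 : 0 < T₁ := ht₀.trans_le (le_max_right _ _)
  set C := (K' * M + b / k + 1) * Real.exp (k * T₁) with hC
  have hCge : K' * M ≤ C := by
    have h1 : K' * M + b / k + 1 ≤ C := le_mul_of_one_le_right (by positivity)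
      (Real.one_le_exp (by positivity))
    have : 0 ≤ b / k := by positivity
    linarith
  refine ⟨C, by positivity, ?_⟩
  intro ε p p' R V W hε hεε hadm hV hW hVl hWl
  have hVM := hM ε p p' R V hε hεε hadm hV hVl
  have hlim : Tendsto (fun t => V t - W t) atTop (𝓝 0) := by simpa using hVl.sub hWl
  have hfar : ∀ t, T₁ ≤ t → ‖V t - W t‖ ≤ K' * M * ε := by
    intro t ht
    have ht1 : 1 ≤ t := by linarith [le_max_left T t₀]
    have h := H T₁ (ε * M) ε p p' R V W 0 d.P (le_max_left _ _) (by positivity) hε hεε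
      (hadm.mono (le_max_right _ _)) (fun s hs => hV s (hT₁0.trans_le hs))
      (fun s hs => hW s (hT₁0.trans_le hs))
      (fun s hs => by
        have h1 := mul_le_mul_of_nonneg_left (hVM s ((le_max_right _ _).trans hs)) hε
        have h2 : 0 ≤ ε₀ * ‖V s - W s‖ := by positivity
        linarith) hVl (by simpa using hlim) t ht
    rw [zero_smul, sub_zero, norm_zero, zero_add] at h
    have h2 : t ^ (-σ) ≤ 1 := Real.rpow_le_one_of_one_le_of_nonpos ht1 (by linarith)
    refine h.trans ?_
    calc K' * (ε * M * t ^ (-σ)) ≤ K' * (ε * M * 1) := by gcongr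
      _ = _ := by ring
  intro t ht
  rcases le_total T₁ t with h | h
  · exact (hfar t h).trans (mul_le_mul_of_nonneg_right hCge hε)
  · have h1 := norm_le_exp_backward (f := fun s => V s - W s) (δ := K' * M * ε) (K := k)
      (ε := b * ε) h hk0 (by positivity)
      (fun s hs => (hV s (ht₀.trans_le (ht.trans hs.1))).sub
        (hW s (ht₀.trans_le (ht.trans hs.1)))) (hfar T₁ le_rfl) (fun s hs => by
        have hs0 : t₀ ≤ s := ht.trans hs.1
        have hs' : 0 < s := ht₀.trans_le hs0
        have e1 : d.gen p R s (V s) - d.gen (fun _ => 0) (fun _ => 0) s (W s)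
            = d.gen (fun _ => 0) (fun _ => 0) s (V s - W s) + (p s • d.D (V s) + R s (V s)) := by
          simp only [gen, add_apply, smul_apply, map_sub, zero_smul, add_zero]
          abel
        rw [e1]
        refine norm_add_le_of_le ?_ ?_
        · refine (ContinuousLinearMap.le_opNorm _ _).trans
            (mul_le_mul_of_nonneg_right ?_ (norm_nonneg _))
          exact (d.norm_gen_le hσ ht₀ le_rfl hε₀ (admissible_zero σ t₀) hs0).trans (by linarith)
        · have h2 : s ^ (-σ) ≤ t₀ ^ (-σ) := Real.rpow_le_rpow_of_nonpos ht₀ hs0 (by linarith)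
          have h3 : s ^ (-σ - 1) ≤ t₀ ^ (-σ - 1) :=
            Real.rpow_le_rpow_of_nonpos ht₀ hs0 (by linarith)
          have h4 : ‖p s • d.D (V s)‖ ≤ (ε * t₀ ^ (-σ)) * (‖d.D‖ * M) := by
            rw [norm_smul]
            refine mul_le_mul ((hadm.2 s hs0).trans (mul_le_mul_of_nonneg_left h2 hε)) ?_
              (norm_nonneg _) (by positivity)
            exact (d.D.le_opNorm _).trans
              (mul_le_mul_of_nonneg_left (hVM s hs0) (norm_nonneg _))
          have h5 : ‖R s (V s)‖ ≤ (ε * t₀ ^ (-σ - 1)) * M :=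
            ((R s).le_opNorm _).trans (mul_le_mul ((hadm.4 s hs0).trans
              (mul_le_mul_of_nonneg_left h3 hε)) (hVM s hs0) (norm_nonneg _) (by positivity))
          refine (norm_add_le_of_le h4 h5).trans (le_of_eq ?_)
          rw [hb]
          ring)
    refine h1.trans ?_
    have h2 : Real.exp (k * (T₁ - t)) ≤ Real.exp (k * T₁) :=
      Real.exp_le_exp.2 (mul_le_mul_of_nonneg_left (by linarith) hk0.le)
    calc (K' * M * ε + b * ε / k) * Real.exp (k * (T₁ - t))
        ≤ (K' * M * ε + b * ε / k) * Real.exp (k * T₁) := by gcongr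
      _ = (K' * M + b / k) * Real.exp (k * T₁) * ε := by ring
      _ ≤ C * ε := by
        rw [hC]
        refine mul_le_mul_of_nonneg_right (mul_le_mul_of_nonneg_right ?_ (Real.exp_pos _).le) hε
        linarith

end SplitData
end KullAnisimov

namespace KullAnisimov

/-! ### Decay of the density profile -/

namespace IsProfile

variable {ν : ℝ} {ξ : ℝ → ℝ}

theorem hasDerivAt_comp_neg (hξ : IsProfile ν ξ) (s : ℝ) :
    HasDerivAt (fun s => ξ (-s)) (-(ξ (-s) ^ (ν + 1) * (1 - ξ (-s)))) s := by
  have h := (hξ.hasDerivAt (-s)).scomp s (hasDerivAt_id s).neg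
  simp only [smul_eq_mul, neg_mul, one_mul] at h
  exact h

/-- The explicit solution of `f' = -f^(ν+1)` with the same initial value stays below the profile. -/
theorem lower_bound (hν : 0 < ν) (hξ : IsProfile ν ξ) {s : ℝ} (hs : 0 ≤ s) :
    (((ν + 1) / (ν + 2)) ^ (-ν) + ν * s) ^ (-(1 / ν)) ≤ ξ (-s) := by
  set u₀ : ℝ := (ν + 1) / (ν + 2) with hu₀
  have hu₀0 : 0 < u₀ := by positivity
  have hbase : ∀ r, 0 ≤ r → 0 < u₀ ^ (-ν) + ν * r := fun r hr => by positivity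
  have hder : ∀ r, 0 ≤ r → HasDerivAt (fun r => (u₀ ^ (-ν) + ν * r) ^ (-(1 / ν)))
      (-((u₀ ^ (-ν) + ν * r) ^ (-(1 / ν))) ^ (ν + 1)) r := fun r hr => by
    have h1 : HasDerivAt (fun r => u₀ ^ (-ν) + ν * r) ν r := by
      simpa using ((hasDerivAt_id r).const_mul ν).const_add (u₀ ^ (-ν))
    refine (h1.rpow_const (p := -(1 / ν)) (Or.inl (hbase r hr).ne')).congr_deriv ?_
    rw [← Real.rpow_mul (hbase r hr).le]
    have h2 : -(1 / ν) * (ν + 1) = -(1 / ν) - 1 := by field_simp; ring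
    rw [h2]
    field_simp
  refine image_le_of_deriv_right_lt_deriv_boundary' (a := 0) (b := s)
    (f := fun r => (u₀ ^ (-ν) + ν * r) ^ (-(1 / ν)))
    (f' := fun r => -((u₀ ^ (-ν) + ν * r) ^ (-(1 / ν))) ^ (ν + 1)) (B := fun r => ξ (-r))
    (B' := fun r => -(ξ (-r) ^ (ν + 1) * (1 - ξ (-r))))
    (fun r hr => (hder r hr.1).continuousAt.continuousWithinAt)
    (fun r hr => (hder r hr.1).hasDerivWithinAt) ?_
    (fun r _ => (hξ.hasDerivAt_comp_neg r).continuousAt.continuousWithinAt)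
    (fun r _ => (hξ.hasDerivAt_comp_neg r).hasDerivWithinAt) ?_ (right_mem_Icc.2 hs)
  · simp only [mul_zero, add_zero, neg_zero, hξ.initial, ← hu₀]
    rw [← Real.rpow_mul hu₀0.le]
    have : -ν * -(1 / ν) = 1 := by field_simp
    rw [this, Real.rpow_one]
  · intro r hr heq
    have hpos : 0 < ξ (-r) := by
      rw [← heq]
      exact Real.rpow_pos_of_pos (hbase r hr.1) _
    simp only [heq]
    have : 0 < ξ (-r) ^ (ν + 1) := Real.rpow_pos_of_pos hpos _
    nlinarith

theorem pos (hν : 0 < ν) (hξ : IsProfile ν ξ) {s : ℝ} (hs : 0 ≤ s) : 0 < ξ (-s) :=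
  lt_of_lt_of_le (Real.rpow_pos_of_pos (by positivity) _) (hξ.lower_bound hν hs)

theorem upper_bound (hν : 0 < ν) (hξ : IsProfile ν ξ) {s : ℝ} (hs : 0 ≤ s) :
    ξ (-s) ≤ (ν + 1) / (ν + 2) := by
  refine image_le_of_deriv_right_lt_deriv_boundary' (a := 0) (b := s)
    (f := fun r => ξ (-r)) (f' := fun r => -(ξ (-r) ^ (ν + 1) * (1 - ξ (-r))))
    (B := fun _ => (ν + 1) / (ν + 2)) (B' := fun _ => 0)
    (fun r _ => (hξ.hasDerivAt_comp_neg r).continuousAt.continuousWithinAt)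
    (fun r _ => (hξ.hasDerivAt_comp_neg r).hasDerivWithinAt) (by simp [hξ.initial])
    continuousOn_const (fun r _ => (hasDerivAt_const r _).hasDerivWithinAt) ?_
    (right_mem_Icc.2 hs)
  intro r hr heq
  have h1 : 0 < ξ (-r) ^ (ν + 1) := Real.rpow_pos_of_pos (hξ.pos hν hr.1) _
  have h2 : (ν + 1) / (ν + 2) < 1 := by
    rw [div_lt_one (by linarith)]
    linarith
  have h3 : 0 < 1 - ξ (-r) := by linarith
  have := mul_pos h1 h3
  linarith

theorem lt_one (hν : 0 < ν) (hξ : IsProfile ν ξ) {s : ℝ} (hs : 0 ≤ s) : ξ (-s) < 1 := by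
  refine (hξ.upper_bound hν hs).trans_lt ?_
  rw [div_lt_one (by linarith)]
  linarith

/-- In terms of `w = ξ^(-ν)` the profile equation is almost linear: `w' = ν (1 - ξ)`. -/
theorem hasDerivAt_rpow_neg (hν : 0 < ν) (hξ : IsProfile ν ξ) {s : ℝ} (hs : 0 ≤ s) :
    HasDerivAt (fun s => ξ (-s) ^ (-ν)) (ν * (1 - ξ (-s))) s := by
  have hpos := hξ.pos hν hs
  refine ((hξ.hasDerivAt_comp_neg s).rpow_const (p := -ν) (Or.inl hpos.ne')).congr_deriv ?_
  have h1 : ξ (-s) ^ (ν + 1) * ξ (-s) ^ (-ν - 1) = 1 := by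
    rw [← Real.rpow_add hpos]
    have : ν + 1 + (-ν - 1) = 0 := by ring
    rw [this, Real.rpow_zero]
  linear_combination (ν * (1 - ξ (-s))) * h1

theorem one_add_le_rpow_neg (hν : 0 < ν) (hξ : IsProfile ν ξ) {s : ℝ} (hs : 0 ≤ s) :
    ν / (ν + 2) * (1 + s) ≤ ξ (-s) ^ (-ν) := by
  have h := norm_sub_le_of_norm_deriv_le (f := fun r : ℝ => ν / (ν + 2) * r)
    (f' := fun _ => ν / (ν + 2))
    (B := fun r => ξ (-r) ^ (-ν)) (B' := fun r => ν * (1 - ξ (-r))) hs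
    (fun r _ => by simpa using (hasDerivAt_id r).const_mul (ν / (ν + 2)))
    (fun r hr => hξ.hasDerivAt_rpow_neg hν hr.1) (fun r hr => by
      rw [Real.norm_of_nonneg (by positivity)]
      have h1 := hξ.upper_bound hν hr.1
      have h2 : ν / (ν + 2) = ν * (1 - (ν + 1) / (ν + 2)) := by field_simp; ring
      rw [h2]
      exact mul_le_mul_of_nonneg_left (by linarith) hν.le)
  have h0 : 1 ≤ ξ (-0) ^ (-ν) :=
    Real.one_le_rpow_of_pos_of_le_one_of_nonpos (hξ.pos hν le_rfl) (hξ.lt_one hν le_rfl).le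
      (by linarith)
  have h3 : ν / (ν + 2) ≤ 1 := by
    rw [div_le_one (by linarith)]
    linarith
  have h4 := le_of_abs_le h
  simp only [mul_zero, sub_zero, neg_zero] at h4 h0
  rw [mul_add, mul_one]
  linarith

theorem le_rpow_neg (hν : 0 < ν) (hξ : IsProfile ν ξ) {σ : ℝ} (hσ : 0 < σ) (hσν : σ * ν ≤ 1)
    {s : ℝ} (hs : 0 ≤ s) : ξ (-s) ≤ (ν / (ν + 2)) ^ (-σ) * (1 + s) ^ (-σ) := by
  have hpos := hξ.pos hν hs
  have h1 : ξ (-s) ≤ ξ (-s) ^ (ν * σ) := by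
    have := Real.rpow_le_rpow_of_exponent_ge hpos (hξ.lt_one hν hs).le
      (by linarith : ν * σ ≤ 1)
    rwa [Real.rpow_one] at this
  have h2 : ξ (-s) ^ (ν * σ) = (ξ (-s) ^ (-ν)) ^ (-σ) := by
    rw [← Real.rpow_mul hpos.le]
    congr 1
    ring
  rw [h2] at h1
  refine h1.trans ?_
  rw [← Real.mul_rpow (by positivity) (by positivity)]
  exact Real.rpow_le_rpow_of_nonpos (by positivity) (hξ.one_add_le_rpow_neg hν hs) (by linarith)

theorem exists_abs_sub_le (hν : 0 < ν) (hξ : IsProfile ν ξ) {σ : ℝ} (hσ : 0 < σ) (hσ1 : σ < 1)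
    (hσν : σ * ν ≤ 1) :
    ∃ C : ℝ, 0 < C ∧ ∀ s, 0 ≤ s → |ν * s - ξ (-s) ^ (-ν)| ≤ C * (1 + s) ^ (1 - σ) := by
  set c : ℝ := ν * (ν / (ν + 2)) ^ (-σ) / (1 - σ) with hc
  have h1σ : 0 < 1 - σ := by linarith
  have hc0 : 0 < c := by positivity
  set w₀ : ℝ := ξ (-0) ^ (-ν) with hw₀
  have hw₀0 : 0 < w₀ := Real.rpow_pos_of_pos (hξ.pos hν le_rfl) _
  refine ⟨w₀ + c, by positivity, fun s hs => ?_⟩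
  have h := norm_sub_le_of_norm_deriv_le (f := fun r : ℝ => ν * r - ξ (-r) ^ (-ν))
    (f' := fun r => ν * ξ (-r))
    (B := fun r => c * (1 + r) ^ (1 - σ)) (B' := fun r => c * (1 - σ) * (1 + r) ^ (-σ)) hs
    (fun r hr => by
      have h1 : HasDerivAt (fun r : ℝ => ν * r) ν r := by
        simpa using (hasDerivAt_id r).const_mul ν
      refine (h1.sub (hξ.hasDerivAt_rpow_neg hν hr.1)).congr_deriv (by ring))
    (fun r hr => by
      have h1 : HasDerivAt (fun r : ℝ => 1 + r) 1 r := (hasDerivAt_id r).const_add 1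
      have h2 : (1 + r) ≠ 0 := by
        have := hr.1
        positivity
      refine ((h1.rpow_const (p := 1 - σ) (Or.inl h2)).const_mul c).congr_deriv ?_
      have : 1 - σ - 1 = -σ := by ring
      rw [this]
      ring)
    (fun r hr => by
      have hp := hξ.pos hν hr.1
      rw [Real.norm_of_nonneg (by positivity)]
      have h1 := mul_le_mul_of_nonneg_left (hξ.le_rpow_neg hν hσ hσν hr.1) hν.le
      have h2 : c * (1 - σ) = ν * (ν / (ν + 2)) ^ (-σ) := by
        rw [hc]
        field_simp
      rw [h2]
      linarith)
  have h1 : 1 ≤ (1 + s) ^ (1 - σ) := Real.one_le_rpow (by linarith) h1σ.le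
  simp only [mul_zero, zero_sub, ← hw₀, add_zero, Real.one_rpow, mul_one, Real.norm_eq_abs] at h
  have h2 := abs_sub_abs_le_abs_sub (ν * s - ξ (-s) ^ (-ν)) (-w₀)
  rw [abs_neg, abs_of_pos hw₀0] at h2
  nlinarith

end IsProfile

section Scaling

variable {ν : ℝ} {ξ : ℝ → ℝ} {α β t : ℝ}

theorem rpow_mul_eta (hα : 0 < α) : α ^ (1 / ν) * eta ν ξ α β t = ξ (-t / (α * β)) := by
  have : 0 < α ^ (1 / ν) := Real.rpow_pos_of_pos hα _
  rw [eta]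
  field_simp

theorem eta_rpow (hν : 0 < ν) (hα : 0 < α) (hx : 0 < ξ (-t / (α * β))) :
    eta ν ξ α β t ^ ν = ξ (-t / (α * β)) ^ ν / α := by
  rw [eta, Real.div_rpow hx.le (Real.rpow_nonneg hα.le _), ← Real.rpow_mul hα.le,
    one_div_mul_cancel hν.ne', Real.rpow_one]

theorem IsProfile.scaled_pos (hν : 0 < ν) (hξ : IsProfile ν ξ) (hα : 0 < α) (hβ : 0 < β)
    (ht : 0 < t) : 0 < ξ (-t / (α * β)) := by
  rw [neg_div]
  exact hξ.pos hν (by positivity)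

theorem IsProfile.scaled_lt_one (hν : 0 < ν) (hξ : IsProfile ν ξ) (hα : 0 < α) (hβ : 0 < β)
    (ht : 0 < t) : ξ (-t / (α * β)) < 1 := by
  rw [neg_div]
  exact hξ.lt_one hν (by positivity)

theorem IsProfile.hasDerivAt_scaled (hν : 0 < ν) (hξ : IsProfile ν ξ) (hα : 0 < α) (hβ : 0 < β)
    (ht : 0 < t) :
    HasDerivAt (fun t => ξ (-t / (α * β)))
      (-(ξ (-t / (α * β)) * (eta ν ξ α β t ^ ν / β) * (1 - ξ (-t / (α * β))))) t := by
  have hx := hξ.scaled_pos hν hα hβ ht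
  have h1 : HasDerivAt (fun t : ℝ => -t / (α * β)) (-1 / (α * β)) t :=
    (hasDerivAt_id t).neg.div_const _
  have h2 := (hξ.hasDerivAt (-t / (α * β))).scomp t h1
  refine h2.congr_deriv ?_
  rw [eta_rpow hν hα hx, Real.rpow_add hx, Real.rpow_one, smul_eq_mul]
  field_simp

/-- Uniform decay: with `s = t / (α β)`, the profile is `O(s^(-σ))`, and `η^ν / β` agrees with
`1 / (ν t)` up to `O(s^(-σ) / t)`. -/
theorem IsProfile.exists_scaled_bounds (hν : 0 < ν) (hξ : IsProfile ν ξ) {σ : ℝ} (hσ : 0 < σ)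
    (hσ1 : σ < 1) (hσν : σ * ν ≤ 1) :
    ∃ C : ℝ, 0 < C ∧ ∀ α β t : ℝ, 0 < α → 0 < β → 0 < t →
      0 < eta ν ξ α β t ^ ν / β ∧ eta ν ξ α β t ^ ν / β ≤ C / t ∧
      ξ (-t / (α * β)) ≤ C * ((α * β) ^ σ * t ^ (-σ)) ∧
      |eta ν ξ α β t ^ ν / β - 1 / (ν * t)| ≤ C * ((α * β) ^ σ * t ^ (-σ - 1)) := by
  obtain ⟨c, hc, hc'⟩ := hξ.exists_abs_sub_le hν hσ hσ1 hσν
  have hb0 : 0 < ν / (ν + 2) := by positivity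
  set b := ν / (ν + 2) with hb
  refine ⟨1 / b + b ^ (-σ) + c / (b * ν), by positivity, fun α β t hα hβ ht => ?_⟩
  set s := t / (α * β) with hs
  have hs0 : 0 < s := by positivity
  have hts : t = α * β * s := by
    rw [hs]
    field_simp
  have hneg : -t / (α * β) = -s := by rw [neg_div]
  have hx := hξ.scaled_pos hν hα hβ ht
  have hq : eta ν ξ α β t ^ ν / β = 1 / (α * β * ξ (-s) ^ (-ν)) := by
    rw [eta_rpow hν hα hx, hneg, Real.rpow_neg (hξ.pos hν hs0.le).le]
    have : 0 < ξ (-s) ^ ν := Real.rpow_pos_of_pos (hξ.pos hν hs0.le) _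
    field_simp
  have hw := hξ.one_add_le_rpow_neg hν hs0.le
  rw [← hb] at hw
  set w := ξ (-s) ^ (-ν) with hwdef
  have hw0 : 0 < w := lt_of_lt_of_le (by positivity) hw
  have hsσ : s ^ (-σ) = (α * β) ^ σ * t ^ (-σ) := by
    rw [hs, Real.div_rpow ht.le (by positivity), Real.rpow_neg (by positivity : 0 ≤ α * β)]
    field_simp
  have h1s : (1 + s) ^ (-σ) ≤ s ^ (-σ) :=
    Real.rpow_le_rpow_of_nonpos hs0 (by linarith) (by linarith)
  have hsσ0 : 0 < s ^ (-σ) := Real.rpow_pos_of_pos hs0 _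
  refine ⟨?_, ?_, ?_, ?_⟩
  · rw [hq]
    positivity
  · rw [hq, hts]
    have h1 : 1 / (α * β * w) ≤ 1 / b / (α * β * s) := by
      rw [div_div]
      refine one_div_le_one_div_of_le (by positivity) ?_
      have : b * s ≤ w := le_trans (by nlinarith) hw
      have := mul_le_mul_of_nonneg_left this (by positivity : 0 ≤ α * β)
      linarith
    refine h1.trans (div_le_div_of_nonneg_right ?_ (by positivity))
    have : 0 ≤ b ^ (-σ) + c / (b * ν) := by positivity
    linarith
  · rw [hneg, ← hsσ]
    refine (hξ.le_rpow_neg hν hσ hσν hs0.le).trans ?_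
    have h1 : 0 ≤ 1 / b + c / (b * ν) := by positivity
    have h2 : 0 < b ^ (-σ) := by positivity
    calc b ^ (-σ) * (1 + s) ^ (-σ) ≤ b ^ (-σ) * s ^ (-σ) := by gcongr
      _ ≤ _ := mul_le_mul_of_nonneg_right (by linarith) hsσ0.le
  · have e1 : (α * β) ^ σ * t ^ (-σ - 1) = s ^ (-σ) / t := by
      rw [hsσ, Real.rpow_sub ht, Real.rpow_one]
      ring
    have e2 : eta ν ξ α β t ^ ν / β - 1 / (ν * t) = (ν * s - w) / (w * ν * t) := by
      rw [hq, hts]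
      field_simp
    rw [e1, e2, abs_div, abs_of_pos (by positivity : 0 < w * ν * t)]
    have h1 : (1 + s) ^ (1 - σ) = (1 + s) * (1 + s) ^ (-σ) := by
      rw [sub_eq_add_neg, Real.rpow_add (by linarith), Real.rpow_one]
    have h2 : |ν * s - w| ≤ c / b * w * s ^ (-σ) := by
      refine (hc' s hs0.le).trans ?_
      rw [h1]
      have h3 : 1 + s ≤ w / b := by
        rw [le_div_iff₀ hb0]
        linarith
      calc c * ((1 + s) * (1 + s) ^ (-σ)) ≤ c * (w / b * s ^ (-σ)) := by gcongr
        _ = _ := by ring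
    calc |ν * s - w| / (w * ν * t) ≤ (c / b * w * s ^ (-σ)) / (w * ν * t) := by gcongr
      _ = c / (b * ν) * (s ^ (-σ) / t) := by field_simp
      _ ≤ _ := by
        refine mul_le_mul_of_nonneg_right ?_ (by positivity)
        have : 0 ≤ 1 / b + b ^ (-σ) := by positivity
        linarith

end Scaling

end KullAnisimov

namespace KullAnisimov

/-! ### Induced operators on the third exterior power -/

section Exterior

variable {R M : Type*} [CommRing R] [AddCommGroup M] [Module R M]

theorem extDerivation_add (n : ℕ) (A B : M →ₗ[R] M) :
    extDerivation n (A + B) = extDerivation n A + extDerivation n B := by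
  refine exteriorPower.linearMap_ext (AlternatingMap.ext fun v => ?_)
  simp [extDerivation_ιMulti, AlternatingMap.map_update_add, Finset.sum_add_distrib]

theorem extDerivation_smul (n : ℕ) (c : R) (A : M →ₗ[R] M) :
    extDerivation n (c • A) = c • extDerivation n A := by
  refine exteriorPower.linearMap_ext (AlternatingMap.ext fun v => ?_)
  simp [extDerivation_ιMulti, AlternatingMap.map_update_smul, Finset.smul_sum]

/-- A wedge product of eigenvectors is an eigenvector of the induced operator, the eigenvalues
being added. -/
theorem extDerivation_eigenvector {n : ℕ} {A : M →ₗ[R] M} {v : Fin n → M} {μ : Fin n → R}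
    (h : ∀ l, A (v l) = μ l • v l) :
    extDerivation n A (exteriorPower.ιMulti R n v)
      = (∑ l, μ l) • exteriorPower.ιMulti R n v := by
  rw [extDerivation_ιMulti, Finset.sum_smul]
  refine Finset.sum_congr rfl fun l _ => ?_
  rw [h, AlternatingMap.map_update_smul, Function.update_eq_self]

/-- The product `a ∧ b ∧ c`. -/
noncomputable def tri (a b c : M) : ⋀[R]^3 M := exteriorPower.ιMulti R 3 ![a, b, c]

theorem tri_add_left (a a' b c : M) : tri (R := R) (a + a') b c = tri a b c + tri a' b c := by
  have e : ∀ x, Function.update ![a, b, c] 0 x = ![x, b, c] := fun x => by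
    funext i
    fin_cases i <;> rfl
  have := (exteriorPower.ιMulti R 3 (M := M)).map_update_add ![a, b, c] 0 a a'
  simpa only [tri, e] using this

theorem tri_add_mid (a b b' c : M) : tri (R := R) a (b + b') c = tri a b c + tri a b' c := by
  have e : ∀ x, Function.update ![a, b, c] 1 x = ![a, x, c] := fun x => by
    funext i
    fin_cases i <;> rfl
  have := (exteriorPower.ιMulti R 3 (M := M)).map_update_add ![a, b, c] 1 b b'
  simpa only [tri, e] using this

theorem tri_add_right (a b c c' : M) : tri (R := R) a b (c + c') = tri a b c + tri a b c' := by
  have e : ∀ x, Function.update ![a, b, c] 2 x = ![a, b, x] := fun x => by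
    funext i
    fin_cases i <;> rfl
  have := (exteriorPower.ιMulti R 3 (M := M)).map_update_add ![a, b, c] 2 c c'
  simpa only [tri, e] using this

theorem tri_smul_left (r : R) (a b c : M) : tri (R := R) (r • a) b c = r • tri a b c := by
  have e : ∀ x, Function.update ![a, b, c] 0 x = ![x, b, c] := fun x => by
    funext i
    fin_cases i <;> rfl
  have := (exteriorPower.ιMulti R 3 (M := M)).map_update_smul ![a, b, c] 0 r a
  simpa only [tri, e] using this

theorem tri_smul_mid (r : R) (a b c : M) : tri (R := R) a (r • b) c = r • tri a b c := by
  have e : ∀ x, Function.update ![a, b, c] 1 x = ![a, x, c] := fun x => by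
    funext i
    fin_cases i <;> rfl
  have := (exteriorPower.ιMulti R 3 (M := M)).map_update_smul ![a, b, c] 1 r b
  simpa only [tri, e] using this

theorem tri_smul_right (r : R) (a b c : M) : tri (R := R) a b (r • c) = r • tri a b c := by
  have e : ∀ x, Function.update ![a, b, c] 2 x = ![a, b, x] := fun x => by
    funext i
    fin_cases i <;> rfl
  have := (exteriorPower.ιMulti R 3 (M := M)).map_update_smul ![a, b, c] 2 r c
  simpa only [tri, e] using this

theorem tri_self_left (a c : M) : tri (R := R) a a c = 0 :=
  (exteriorPower.ιMulti R 3 (M := M)).map_eq_zero_of_eq ![a, a, c] (i := 0) (j := 1) rfl (by decide)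

theorem tri_self_right (a c : M) : tri (R := R) a c c = 0 :=
  (exteriorPower.ιMulti R 3 (M := M)).map_eq_zero_of_eq ![a, c, c] (i := 1) (j := 2) rfl (by decide)

theorem tri_self_outer (a c : M) : tri (R := R) a c a = 0 :=
  (exteriorPower.ιMulti R 3 (M := M)).map_eq_zero_of_eq ![a, c, a] (i := 0) (j := 2) rfl (by decide)

theorem tri_swap_left (a b c : M) : tri (R := R) a b c = -tri b a c := by
  have h := tri_self_left (R := R) (a + b) c
  rw [tri_add_left, tri_add_mid, tri_add_mid, tri_self_left, tri_self_left, zero_add,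
    add_zero] at h
  exact eq_neg_of_add_eq_zero_left h

theorem tri_swap_right (a b c : M) : tri (R := R) a b c = -tri a c b := by
  have h := tri_self_right (R := R) a (b + c)
  rw [tri_add_mid, tri_add_right, tri_add_right, tri_self_right, tri_self_right, zero_add,
    add_zero] at h
  exact eq_neg_of_add_eq_zero_left h

/-- The linear form `f ∧ g ∧ h` on the third exterior power. -/
noncomputable def triForm (f g h : Module.Dual R M) : ⋀[R]^3 M →ₗ[R] R :=
  exteriorPower.pairingDual R M 3 (tri f g h)

theorem triForm_tri (f g h : Module.Dual R M) (a b c : M) :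
    triForm f g h (tri a b c) = f a * (g b * h c - g c * h b) - f b * (g a * h c - g c * h a)
      + f c * (g a * h b - g b * h a) := by
  rw [triForm, tri, tri, exteriorPower.pairingDual_ιMulti_ιMulti, Matrix.det_fin_three]
  simp
  ring

/-- The transpose of an induced operator acts on `f ∧ g ∧ h` by the Leibniz rule. -/
theorem triForm_extDerivation (f g h : Module.Dual R M) (A : M →ₗ[R] M) (U : ⋀[R]^3 M) :
    triForm f g h (extDerivation 3 A U) = triForm (f ∘ₗ A) g h U + triForm f (g ∘ₗ A) h U
      + triForm f g (h ∘ₗ A) U := by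
  have : triForm f g h ∘ₗ extDerivation 3 A = triForm (f ∘ₗ A) g h + triForm f (g ∘ₗ A) h
      + triForm f g (h ∘ₗ A) := by
    refine exteriorPower.linearMap_ext (AlternatingMap.ext fun v => ?_)
    have hv : v = ![v 0, v 1, v 2] := by
      ext i
      fin_cases i <;> rfl
    have h0 : exteriorPower.ιMulti R 3 v = tri (v 0) (v 1) (v 2) := by rw [tri, ← hv]
    have h1 : extDerivation 3 A (exteriorPower.ιMulti R 3 v) = tri (A (v 0)) (v 1) (v 2)
        + tri (v 0) (A (v 1)) (v 2) + tri (v 0) (v 1) (A (v 2)) := by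
      rw [extDerivation_ιMulti, Fin.sum_univ_three]
      congr 1
    change triForm f g h (extDerivation 3 A (exteriorPower.ιMulti R 3 v))
      = triForm (f ∘ₗ A) g h (exteriorPower.ιMulti R 3 v)
        + triForm f (g ∘ₗ A) h (exteriorPower.ιMulti R 3 v)
        + triForm f g (h ∘ₗ A) (exteriorPower.ιMulti R 3 v)
    rw [h1, h0, map_add, map_add]
    simp only [triForm_tri, LinearMap.comp_apply]
    ring
  exact LinearMap.congr_fun this U

end Exterior

/-! ### The eigenbasis of `M₀(0)` -/

/-- The columns form a basis of eigenvectors of `M₀(0)`, for the eigenvalues `0, -1, -1, 1, 1`. -/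
def eigenMatrix : Matrix (Fin 5) (Fin 5) ℂ :=
  !![1, 1, 0, 1, 0;
     -2, -1, 0, -1, 0;
     0, -1, 0, 1, 0;
     0, 0, 1, 0, 1;
     1, 1, 1, 1, -1]

/-- The inverse of `eigenMatrix`. -/
noncomputable def eigenMatrixInv : Matrix (Fin 5) (Fin 5) ℂ :=
  !![-1, -1, 0, 0, 0;
     1, 1 / 2, -(1 / 2), 0, 0;
     -(1 / 2), 0, 0, 1 / 2, 1 / 2;
     1, 1 / 2, 1 / 2, 0, 0;
     1 / 2, 0, 0, 1 / 2, -(1 / 2)]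

theorem eigenMatrix_mul_inv : eigenMatrix * eigenMatrixInv = 1 := by
  ext i j
  fin_cases i <;> fin_cases j <;>
    simp [eigenMatrix, eigenMatrixInv, Matrix.mul_apply, Fin.sum_univ_five] <;> norm_num

/-- The eigenbasis of `M₀(0)`. -/
noncomputable def eigenBasis : Module.Basis (Fin 5) ℂ (Fin 5 → ℂ) :=
  (Pi.basisFun ℂ (Fin 5)).map
    (Matrix.toLin'OfInv (mul_eq_one_comm.1 eigenMatrix_mul_inv) eigenMatrix_mul_inv)

theorem eigenBasis_apply (i k : Fin 5) : eigenBasis i k = eigenMatrix k i := by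
  simp [eigenBasis, Matrix.toLin'OfInv]

/-- The eigenvalues of `M₀(0)`. -/
def eigenvalue : Fin 5 → ℤ := ![0, -1, -1, 1, 1]

theorem M0_eigenBasis (i : Fin 5) :
    Matrix.toLin' (M0 0) (eigenBasis i) = (eigenvalue i : ℂ) • eigenBasis i := by
  ext k
  rw [Matrix.toLin'_apply, Pi.smul_apply, Matrix.mulVec, dotProduct, Fin.sum_univ_five]
  simp only [eigenBasis_apply]
  fin_cases i <;> fin_cases k <;> simp [M0, eigenMatrix, eigenvalue] <;> norm_num

/-- The basis of wedge products of eigenvectors. -/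
noncomputable def triBasis : Module.Basis (Set.powersetCard (Fin 5) 3) ℂ ThreeVec :=
  eigenBasis.exteriorPower 3

theorem extDerivation_triBasis (s : Set.powersetCard (Fin 5) 3) :
    extDerivation 3 (Matrix.toLin' (M0 0)) (triBasis s)
      = ((∑ i ∈ s.1, eigenvalue i : ℤ) : ℂ) • triBasis s := by
  rw [triBasis, exteriorPower.basis_apply, exteriorPower.ιMulti_family,
    extDerivation_eigenvector (v := eigenBasis ∘ Set.powersetCard.ofFinEmbEquiv.symm s)
      (μ := fun l =>
      (eigenvalue (Set.powersetCard.ofFinEmbEquiv.symm s l) : ℂ)) fun l => M0_eigenBasis _]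
  congr 1
  rw [← Int.cast_sum]
  congr 1
  conv_rhs => rw [← Finset.map_orderEmbOfFin_univ s.1 s.2, Finset.sum_map]
  rfl

/-- The index of the slowest mode. -/
def slow : Set.powersetCard (Fin 5) 3 := ⟨{0, 1, 2}, rfl⟩

theorem neg_one_le_sum_eigenvalue : ∀ s : Finset (Fin 5), s.card = 3 → s ≠ {0, 1, 2} →
    -1 ≤ ∑ i ∈ s, eigenvalue i := by
  decide

theorem triBasis_slow :
    triBasis slow = tri (eigenBasis 0) (eigenBasis 1) (eigenBasis 2) := by
  rw [triBasis, exteriorPower.basis_apply, exteriorPower.ιMulti_family, tri]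
  congr 1
  have h := Finset.orderEmbOfFin_unique (s := slow.1) slow.2 (f := (![0, 1, 2] : Fin 3 → Fin 5))
    (by decide) (by decide)
  ext i k
  have h2 : Set.powersetCard.ofFinEmbEquiv.symm slow i = (![0, 1, 2] : Fin 3 → Fin 5) i := by
    rw [h]
    rfl
  rw [Function.comp_apply, h2]
  fin_cases i <;> rfl

theorem wedge_eq_tri (a b c : Fin 5) :
    wedge a b c = tri (Pi.single a 1) (Pi.single b 1) (Pi.single c 1) := rfl

theorem wedge_swap_left (a b c : Fin 5) : wedge a b c = -wedge b a c := tri_swap_left _ _ _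

theorem wedge_swap_right (a b c : Fin 5) : wedge a b c = -wedge a c b := tri_swap_right _ _ _

theorem P_zero_eq : P 0 = triBasis slow := by
  have e0 : eigenBasis 0 = Pi.single 0 1 + (-2 : ℂ) • Pi.single 1 1 + Pi.single 4 1 := by
    ext k
    rw [eigenBasis_apply]
    fin_cases k <;> simp [eigenMatrix]
  have e1 : eigenBasis 1 = Pi.single 0 1 + (-1 : ℂ) • Pi.single 1 1 + (-1 : ℂ) • Pi.single 2 1
      + Pi.single 4 1 := by
    ext k
    rw [eigenBasis_apply]
    fin_cases k <;> simp [eigenMatrix]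
  have e2 : eigenBasis 2 = Pi.single 3 (1 : ℂ) + Pi.single 4 1 := by
    ext k
    rw [eigenBasis_apply]
    fin_cases k <;> simp [eigenMatrix]
  rw [triBasis_slow, e0, e1, e2]
  simp only [tri_add_left, tri_add_mid, tri_add_right, tri_smul_left, tri_smul_mid,
    tri_self_left, tri_self_right, tri_self_outer, ← wedge_eq_tri, smul_zero, add_zero, zero_add]
  rw [wedge_swap_left 1 0 3, wedge_swap_left 1 0 4, wedge_swap_right 0 4 3,
    wedge_swap_right 1 4 3, wedge_swap_left 4 0 3, wedge_swap_right 0 4 3, wedge_swap_left 4 1 3,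
    wedge_swap_right 1 4 3, wedge_swap_left 4 2 3, wedge_swap_right 2 4 3]
  simp only [P, f1perp, f2perp, f3perp, g1perp, g2perp, g3perp, g5perp, g6perp]
  module

/-! ### The left null vector -/

/-- The first-order part of `M₀(p) = M₀(0) + p D₀`. -/
def D0 : Matrix (Fin 5) (Fin 5) ℂ :=
  !![0, 0, 0, 0, 0;
     1, 0, 0, 0, 0;
     0, 0, -1, 0, 0;
     0, 0, 0, 0, 0;
     0, 0, 0, 0, 0]

theorem M0_eq (p : ℂ) : M0 p = M0 0 + p • D0 := by
  ext i j
  fin_cases i <;> fin_cases j <;> simp [M0, D0]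

/-- The linear form reading off a coordinate. -/
def coordForm (i : Fin 5) : Module.Dual ℂ (Fin 5 → ℂ) := LinearMap.proj i

/-- With `leftRow₂ p` and `leftRow₃`, a basis of the left invariant subspace of `M₀(p)` for the
eigenvalues `-1, -1, -p`, chosen so that the wedge product of the three is affine in `p`. -/
noncomputable def leftRow₁ : Module.Dual ℂ (Fin 5 → ℂ) := coordForm 0 - coordForm 2

/-- See `leftRow₁`. -/
noncomputable def leftRow₂ (p : ℂ) : Module.Dual ℂ (Fin 5 → ℂ) :=
  coordForm 1 + (1 - p) • coordForm 2

/-- See `leftRow₁`. -/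
noncomputable def leftRow₃ : Module.Dual ℂ (Fin 5 → ℂ) :=
  -coordForm 0 + coordForm 3 + coordForm 4

/-- The left eigenvector of `M₀(p)⁽³⁾` for its slowest eigenvalue `-(2 + p)`, normalized by its
value `1` on `P(0)`. -/
noncomputable def leftForm (p : ℂ) : ThreeVec →ₗ[ℂ] ℂ :=
  (1 / 4 : ℂ) • triForm leftRow₁ (leftRow₂ p) leftRow₃

/-- The slope of the affine function `leftForm`. -/
noncomputable def leftFormSlope : ThreeVec →ₗ[ℂ] ℂ :=
  (1 / 4 : ℂ) • triForm leftRow₁ (-coordForm 2) leftRow₃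

theorem leftForm_eq (p : ℂ) : leftForm p = leftForm 0 + p • leftFormSlope := by
  have h : leftRow₂ p = leftRow₂ 0 + p • (-coordForm 2) := by
    simp only [leftRow₂]
    module
  simp only [leftForm, leftFormSlope, triForm, h, tri_add_mid, tri_smul_mid, map_add, map_smul]
  module

theorem leftForm_extDerivation (p : ℂ) (U : ThreeVec) :
    leftForm p (extDerivation 3 (Matrix.toLin' (M0 p)) U) = -(2 + p) * leftForm p U := by
  have h1 : leftRow₁ ∘ₗ Matrix.toLin' (M0 p) = (-2 : ℂ) • leftRow₁ + (-1 : ℂ) • leftRow₂ p := by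
    ext i
    fin_cases i <;> simp [coordForm, leftRow₁, leftRow₂, M0]
    ring
  have h2 : leftRow₂ p ∘ₗ Matrix.toLin' (M0 p) = (2 - p) • leftRow₁ + (1 - p) • leftRow₂ p := by
    ext i
    fin_cases i <;> simp [coordForm, leftRow₁, leftRow₂, M0] <;> ring
  have h3 : leftRow₃ ∘ₗ Matrix.toLin' (M0 p) = (-1 : ℂ) • leftRow₃ := by
    ext i
    fin_cases i <;> simp [coordForm, leftRow₃, M0]
  simp only [leftForm, LinearMap.smul_apply, triForm_extDerivation, h1, h2, h3]
  simp only [triForm, tri_add_left, tri_add_mid, tri_smul_left, tri_smul_mid, tri_smul_right,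
    tri_self_left, smul_zero, add_zero, zero_add, map_smul, LinearMap.smul_apply, smul_eq_mul]
  ring

theorem leftForm_triBasis_slow : leftForm 0 (triBasis slow) = 1 := by
  rw [triBasis_slow, leftForm, LinearMap.smul_apply, triForm_tri]
  simp [coordForm, leftRow₁, leftRow₂, leftRow₃, eigenBasis_apply, eigenMatrix]
  norm_num

/-- The first-order effect of `N` on the slowest eigenvalue: it produces the power
`t^(1/(2ν))`. -/
theorem leftForm_N_triBasis_slow :
    leftForm 0 (extDerivation 3 (Matrix.toLin' N) (triBasis slow)) = 1 / 2 := by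
  have h1 : leftRow₁ ∘ₗ Matrix.toLin' N = coordForm 0 - coordForm 3 := by
    ext i
    fin_cases i <;> simp [coordForm, leftRow₁, N]
  have h2 : leftRow₂ 0 ∘ₗ Matrix.toLin' N = coordForm 3 := by
    ext i
    fin_cases i <;> simp [coordForm, leftRow₂, N]
  have h3 : leftRow₃ ∘ₗ Matrix.toLin' N = -coordForm 0 + coordForm 3 := by
    ext i
    fin_cases i <;> simp [coordForm, leftRow₃, N]
  rw [leftForm, LinearMap.smul_apply, triForm_extDerivation, h1, h2, h3, triBasis_slow,
    triForm_tri, triForm_tri, triForm_tri]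
  simp [coordForm, leftRow₁, leftRow₂, leftRow₃, eigenBasis_apply, eigenMatrix]
  norm_num

/-- The left null vector at `p = 0` is the coordinate of the slowest mode. -/
theorem leftForm_zero : leftForm 0 = triBasis.coord slow := by
  refine triBasis.ext fun s => ?_
  by_cases hs : s = slow
  · subst hs
    simp [leftForm_triBasis_slow]
  · have h1 := leftForm_extDerivation 0 (triBasis s)
    rw [extDerivation_triBasis, map_smul, smul_eq_mul] at h1
    have h2 := neg_one_le_sum_eigenvalue s.1 s.2 fun h => hs (Subtype.ext h)
    have h3 : ((∑ i ∈ s.1, eigenvalue i : ℤ) : ℂ) + 2 ≠ 0 := by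
      have : (∑ i ∈ s.1, eigenvalue i) + 2 ≠ 0 := by omega
      exact_mod_cast this
    have h4 : leftForm 0 (triBasis s) = 0 := by
      refine (mul_eq_zero.1 ?_).resolve_left h3
      linear_combination h1
    rw [h4, Module.Basis.coord_apply, Module.Basis.repr_self, Finsupp.single_eq_of_ne (Ne.symm hs)]

end KullAnisimov

namespace KullAnisimov

/-! ### The three-form systems as perturbed diagonal systems -/

/-- Coordinate vectors of three-vectors. -/
abbrev TriCoords : Type := Set.powersetCard (Fin 5) 3 → ℂ

/-- The operator induced by a matrix on three-vectors, in coordinates. -/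
noncomputable def extOp (A : Matrix (Fin 5) (Fin 5) ℂ) : TriCoords →L[ℂ] TriCoords :=
  LinearMap.toContinuousLinearMap
    (coords.toLinearMap ∘ₗ extDerivation 3 (Matrix.toLin' A) ∘ₗ coords.symm.toLinearMap)

theorem extOp_apply (A : Matrix (Fin 5) (Fin 5) ℂ) (v : TriCoords) :
    extOp A v = coords (extDerivation 3 (Matrix.toLin' A) (coords.symm v)) := rfl

theorem extOp_add (A B : Matrix (Fin 5) (Fin 5) ℂ) : extOp (A + B) = extOp A + extOp B := by
  ext1 v
  simp [extOp_apply, extDerivation_add]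

theorem extOp_smul (c : ℂ) (A : Matrix (Fin 5) (Fin 5) ℂ) : extOp (c • A) = c • extOp A := by
  ext1 v
  simp [extOp_apply, extDerivation_smul]

/-- A linear form on three-vectors, in coordinates. -/
noncomputable def coordsForm (f : ThreeVec →ₗ[ℂ] ℂ) : TriCoords →L[ℂ] ℂ :=
  LinearMap.toContinuousLinearMap (f ∘ₗ coords.symm.toLinearMap)

theorem coordsForm_apply (f : ThreeVec →ₗ[ℂ] ℂ) (v : TriCoords) :
    coordsForm f v = f (coords.symm v) := rfl

/-- The change of coordinates to the basis of wedge products of eigenvectors. -/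
noncomputable def toTriBasis : TriCoords ≃L[ℂ] (Set.powersetCard (Fin 5) 3 → ℂ) :=
  (coords.symm.trans triBasis.equivFun).toContinuousLinearEquiv

/-- The data of the model system after the normalization by `e^{2t} t^(-1/(2ν))`. -/
noncomputable def splitData (ν : ℝ) : SplitData TriCoords (Set.powersetCard (Fin 5) 3) where
  y s := coordsForm (triBasis.coord s)
  rate s := ((∑ i ∈ s.1, eigenvalue i : ℤ) : ℝ) + 2
  i₀ := slow
  P := coords (P 0)
  L := extOp (M0 0) + (2 : ℂ) • ContinuousLinearMap.id ℂ TriCoords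
  D := extOp D0 + ContinuousLinearMap.id ℂ TriCoords
  G := (1 / ν : ℂ) • (extOp N - (1 / 2 : ℂ) • ContinuousLinearMap.id ℂ TriCoords)
  l := coordsForm leftFormSlope
  C₀ := ‖(toTriBasis.symm : (Set.powersetCard (Fin 5) 3 → ℂ) →L[ℂ] TriCoords)‖
  C₀_nonneg := norm_nonneg _
  y_L s v := by
    have h : triBasis.coord s ∘ₗ extDerivation 3 (Matrix.toLin' (M0 0))
        = ((∑ i ∈ s.1, eigenvalue i : ℤ) : ℂ) • triBasis.coord s := by
      refine triBasis.ext fun s' => ?_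
      rw [LinearMap.comp_apply, extDerivation_triBasis, map_smul, LinearMap.smul_apply]
      by_cases hs : s' = s
      · rw [hs]
      · simp [Finsupp.single_eq_of_ne (Ne.symm hs)]
    have h' := LinearMap.congr_fun h (coords.symm v)
    simp only [LinearMap.comp_apply, LinearMap.smul_apply, smul_eq_mul] at h'
    simp only [coordsForm_apply, extOp_apply, add_apply, smul_apply,
      ContinuousLinearMap.id_apply, map_add, map_smul, LinearEquiv.symm_apply_apply, smul_eq_mul,
      h']
    push_cast
    ring
  one_le_rate s hs := by
    have h := neg_one_le_sum_eigenvalue s.1 s.2 fun h => hs (Subtype.ext h)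
    have h' : (-1 : ℝ) ≤ ((∑ i ∈ s.1, eigenvalue i : ℤ) : ℝ) := by exact_mod_cast h
    linarith
  y_P := by simp [coordsForm_apply, P_zero_eq]
  y_P_ne s hs := by simp [coordsForm_apply, P_zero_eq, Finsupp.single_eq_of_ne hs]
  left_null p v := by
    have h := leftForm_extDerivation p (coords.symm v)
    have hM : extDerivation 3 (Matrix.toLin' (M0 p)) = extDerivation 3 (Matrix.toLin' (M0 0))
        + p • extDerivation 3 (Matrix.toLin' D0) := by
      rw [M0_eq p, map_add, map_smul, extDerivation_add, extDerivation_smul]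
    rw [hM, leftForm_eq p, leftForm_zero] at h
    simp only [LinearMap.add_apply, LinearMap.smul_apply, map_add, map_smul, smul_eq_mul] at h
    simp only [coordsForm_apply, extOp_apply, add_apply, smul_apply,
      ContinuousLinearMap.id_apply, map_add, map_smul, LinearEquiv.symm_apply_apply, smul_eq_mul]
    linear_combination h
  norm_le v M h := by
    have hM : 0 ≤ M := (norm_nonneg _).trans (h slow)
    have h1 : ‖toTriBasis v‖ ≤ M := (pi_norm_le_iff_of_nonneg hM).2 h
    have h2 : v = toTriBasis.symm (toTriBasis v) := by simp
    conv_lhs => rw [h2]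
    exact ((toTriBasis.symm : (Set.powersetCard (Fin 5) 3 → ℂ) →L[ℂ] TriCoords).le_opNorm _).trans
      (mul_le_mul_of_nonneg_left h1 (norm_nonneg _))
  y_G_P := by
    have h1 := leftForm_N_triBasis_slow
    rw [leftForm_zero] at h1
    simp only [coordsForm_apply, extOp_apply, sub_apply, smul_apply,
      ContinuousLinearMap.id_apply, map_sub, map_smul, LinearEquiv.symm_apply_apply, P_zero_eq, h1]
    simp

section Remainder

variable (κ : ℕ) (ν : ℝ) (ξ : ℝ → ℝ) (α β : ℝ) (γ : ℂ)

/-- What is left of the coefficients of the full system after subtraction of `M₀(p) + N/(νt)`. -/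
noncomputable def remainder (t : ℝ) : TriCoords →L[ℂ] TriCoords :=
  ((eta ν ξ α β t ^ ν / β * (1 - α ^ (1 / ν) * eta ν ξ α β t) - 1 / (ν * t) : ℝ) : ℂ) •
      extOp (Matrix.single 0 0 1)
    + (((α ^ (1 / ν) : ℝ) : ℂ) * (γ / (β : ℂ) ^ 2) * ((eta ν ξ α β t ^ (ν + 1) : ℝ) : ℂ)) •
      extOp (Matrix.single 0 3 1)
    + ((α ^ (2 / ν) * (1 / β ^ κ) * eta ν ξ α β t ^ (ν + 2) : ℝ) : ℂ) • extOp (Matrix.single 1 3 1)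
    + ((eta ν ξ α β t ^ ν / β - 1 / (ν * t) : ℝ) : ℂ) •
      extOp (Matrix.single 2 3 1 + Matrix.single 3 3 1)

theorem gen_full_apply {t : ℝ} (v : TriCoords) :
    (splitData ν).gen (pFun ν ξ α β γ) (remainder κ ν ξ α β γ) t v
      = extOp (fullMatrix κ ν ξ α β γ t) v
        + (2 + pFun ν ξ α β γ t - ((1 / (2 * ν) / t : ℝ) : ℂ)) • v := by
  have h : fullMatrix κ ν ξ α β γ t = M0 0 + pFun ν ξ α β γ t • D0 + ((1 / (ν * t) : ℝ) : ℂ) • N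
      + (((eta ν ξ α β t ^ ν / β * (1 - α ^ (1 / ν) * eta ν ξ α β t) - 1 / (ν * t) : ℝ) : ℂ) •
          Matrix.single 0 0 1
        + (((α ^ (1 / ν) : ℝ) : ℂ) * (γ / (β : ℂ) ^ 2) * ((eta ν ξ α β t ^ (ν + 1) : ℝ) : ℂ)) •
          Matrix.single 0 3 1
        + ((α ^ (2 / ν) * (1 / β ^ κ) * eta ν ξ α β t ^ (ν + 2) : ℝ) : ℂ) • Matrix.single 1 3 1
        + ((eta ν ξ α β t ^ ν / β - 1 / (ν * t) : ℝ) : ℂ) •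
          (Matrix.single 2 3 1 + Matrix.single 3 3 1)) := by
    ext i j
    fin_cases i <;> fin_cases j <;> simp [fullMatrix, M0, D0, N, Matrix.single]
  rw [h]
  simp only [extOp_add, extOp_smul, SplitData.gen, splitData, remainder, add_apply, smul_apply,
    sub_apply, ContinuousLinearMap.id_apply, smul_add, smul_sub]
  have e1 : ((1 / t : ℝ) : ℂ) * (1 / (ν : ℂ)) = ((1 / (ν * t) : ℝ) : ℂ) := by
    push_cast
    rw [div_mul_div_comm, one_mul, mul_comm]
  have e2 : ((1 / (2 * ν) / t : ℝ) : ℂ) = ((1 / t : ℝ) : ℂ) * (1 / (ν : ℂ)) * (1 / 2) := by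
    push_cast
    rw [div_mul_div_comm, div_mul_div_comm, div_div]
    ring
  rw [e2, ← e1]
  module

theorem gen_model_apply {t : ℝ} (v : TriCoords) :
    (splitData ν).gen (fun _ => 0) (fun _ => 0) t v
      = extOp (modelMatrix ν t) v + (2 - ((1 / (2 * ν) / t : ℝ) : ℂ)) • v := by
  rw [modelMatrix]
  simp only [extOp_add, extOp_smul, SplitData.gen, splitData, add_apply, smul_apply,
    sub_apply, ContinuousLinearMap.id_apply, smul_add, smul_sub, zero_smul, add_zero]
  have e1 : ((1 / t : ℝ) : ℂ) * (1 / (ν : ℂ)) = ((1 / (ν * t) : ℝ) : ℂ) := by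
    push_cast
    rw [div_mul_div_comm, one_mul, mul_comm]
  have e2 : ((1 / (2 * ν) / t : ℝ) : ℂ) = ((1 / t : ℝ) : ℂ) * (1 / (ν : ℂ)) * (1 / 2) := by
    push_cast
    rw [div_mul_div_comm, div_mul_div_comm, div_div]
    ring
  rw [e2, ← e1]
  module

end Remainder

section Bounds

variable {κ : ℕ} {ν : ℝ} {ξ : ℝ → ℝ} {α β : ℝ} {γ : ℂ}

theorem pFun_eq (hα : 0 < α) (t : ℝ) :
    pFun ν ξ α β γ t = γ / (β : ℂ) * ((ξ (-t / (α * β)) : ℝ) : ℂ) := by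
  rw [pFun, ← rpow_mul_eta (ν := ν) (ξ := ξ) (β := β) (t := t) hα]
  push_cast
  ring

/-- The derivative of `p`. -/
noncomputable def pDeriv (ν : ℝ) (ξ : ℝ → ℝ) (α β : ℝ) (γ : ℂ) (t : ℝ) : ℂ :=
  γ / (β : ℂ) *
    ((-(ξ (-t / (α * β)) * (eta ν ξ α β t ^ ν / β) * (1 - ξ (-t / (α * β)))) : ℝ) : ℂ)

theorem hasDerivAt_pFun (hν : 0 < ν) (hξ : IsProfile ν ξ) (hα : 0 < α) (hβ : 0 < β) {t : ℝ}
    (ht : 0 < t) : HasDerivAt (pFun ν ξ α β γ) (pDeriv ν ξ α β γ t) t := by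
  have h : pFun ν ξ α β γ = fun t => γ / (β : ℂ) * ((ξ (-t / (α * β)) : ℝ) : ℂ) :=
    funext fun t => pFun_eq hα t
  rw [h]
  exact (hξ.hasDerivAt_scaled hν hα hβ ht).ofReal_comp.const_mul _

theorem continuous_eta (hξ : IsProfile ν ξ) : Continuous (eta ν ξ α β) := by
  have hc : Continuous ξ := continuous_iff_continuousAt.2 fun y => (hξ.hasDerivAt y).continuousAt
  unfold eta
  fun_prop

theorem eta_pos (hν : 0 < ν) (hξ : IsProfile ν ξ) (hα : 0 < α) (hβ : 0 < β) {t : ℝ}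
    (ht : 0 < t) : 0 < eta ν ξ α β t :=
  div_pos (hξ.scaled_pos hν hα hβ ht) (Real.rpow_pos_of_pos hα _)

theorem continuousOn_gen_full (hν : 0 < ν) (hξ : IsProfile ν ξ) (hα : 0 < α) (hβ : 0 < β) :
    ContinuousOn ((splitData ν).gen (pFun ν ξ α β γ) (remainder κ ν ξ α β γ)) (Ioi 0) := by
  have hp : ContinuousOn (pFun ν ξ α β γ) (Ioi 0) := fun t ht =>
    (hasDerivAt_pFun hν hξ hα hβ ht).continuousAt.continuousWithinAt
  have hη : ContinuousOn (eta ν ξ α β) (Ioi 0) := (continuous_eta hξ).continuousOn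
  have hpow : ∀ c : ℝ, ContinuousOn (fun t => eta ν ξ α β t ^ c) (Ioi 0) := fun c =>
    hη.rpow_const fun t ht => Or.inl (eta_pos hν hξ hα hβ ht).ne'
  have hinv : ContinuousOn (fun t : ℝ => 1 / t) (Ioi 0) :=
    continuousOn_const.div continuousOn_id fun t ht => (ne_of_gt ht)
  have hinv' : ContinuousOn (fun t : ℝ => 1 / (ν * t)) (Ioi 0) :=
    continuousOn_const.div (continuousOn_const.mul continuousOn_id) fun t ht =>
      (mul_pos hν ht).ne'
  have hre : ∀ {f : ℝ → ℝ}, ContinuousOn f (Ioi 0) →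
      ContinuousOn (fun t => ((f t : ℝ) : ℂ)) (Ioi 0) := fun hf =>
    Complex.continuous_ofReal.comp_continuousOn hf
  unfold SplitData.gen remainder
  refine (((continuousOn_const.add (hp.smul continuousOn_const)).add
    ((hre hinv).smul continuousOn_const))).add ((((?_ : ContinuousOn _ _).add ?_).add ?_).add ?_)
  · exact (hre ((((hpow ν).div_const β).mul (continuousOn_const.sub
      (continuousOn_const.mul hη))).sub hinv')).smul continuousOn_const
  · exact (continuousOn_const.mul (hre (hpow (ν + 1)))).smul continuousOn_const
  · exact (hre (continuousOn_const.mul (hpow (ν + 2)))).smul continuousOn_const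
  · exact (hre (((hpow ν).div_const β).sub hinv')).smul continuousOn_const

theorem continuousOn_gen_model :
    ContinuousOn ((splitData ν).gen (fun _ => 0) (fun _ => 0)) (Ioi 0) := by
  have hinv : ContinuousOn (fun t : ℝ => 1 / t) (Ioi 0) :=
    continuousOn_const.div continuousOn_id fun t ht => (ne_of_gt ht)
  have h : (splitData ν).gen (fun _ => 0) (fun _ => 0)
      = fun t : ℝ => (splitData ν).L + ((1 / t : ℝ) : ℂ) • (splitData ν).G := by
    funext t
    rw [SplitData.gen, zero_smul, add_zero, add_zero]
  rw [h]
  exact continuousOn_const.add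
    ((Complex.continuous_ofReal.comp_continuousOn hinv).smul continuousOn_const)

set_option maxHeartbeats 1000000 in
/-- The full system is a perturbation of the model system of size `α^σ`, uniformly in the
parameters. -/
theorem exists_admissible (hν : 0 < ν) (hξ : IsProfile ν ξ) (hκ : κ = 2 ∨ κ = 3) {σ β₀ : ℝ}
    (hσ : 0 < σ) (hσ1 : σ < 1) (hσν : σ * ν ≤ 1) (hβ₀ : 0 < β₀) :
    ∃ C : ℝ, 0 < C ∧ ∀ (α₀ α β : ℝ) (γ : ℂ) (t₀ : ℝ), ParamRange α₀ β₀ α β γ → 0 < t₀ →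
      SplitData.Admissible σ (C * α ^ σ) t₀ (pFun ν ξ α β γ) (pDeriv ν ξ α β γ)
        (remainder κ ν ξ α β γ) := by
  obtain ⟨C, hC, hb⟩ := hξ.exists_scaled_bounds hν hσ hσ1 hσν
  set g : ℝ := 1 / β₀ / β₀ with hg
  have hg0 : 0 < g := by positivity
  set k : ℝ := 1 / β₀ + (1 / β₀) ^ 2 with hk
  have hk0 : 0 < k := by positivity
  obtain ⟨X, hX0, hX₁, hX₂, hX₃, hX₄⟩ : ∃ X : ℝ, 0 ≤ X ∧ ‖extOp (Matrix.single 0 0 1)‖ ≤ X ∧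
      ‖extOp (Matrix.single 0 3 1)‖ ≤ X ∧ ‖extOp (Matrix.single 1 3 1)‖ ≤ X ∧
      ‖extOp (Matrix.single 2 3 1 + Matrix.single 3 3 1)‖ ≤ X :=
    ⟨max (max ‖extOp (Matrix.single 0 0 1)‖ ‖extOp (Matrix.single 0 3 1)‖)
      (max ‖extOp (Matrix.single 1 3 1)‖ ‖extOp (Matrix.single 2 3 1 + Matrix.single 3 3 1)‖),
      (norm_nonneg _).trans ((le_max_left _ _).trans (le_max_left _ _)),
      (le_max_left _ _).trans (le_max_left _ _), (le_max_right _ _).trans (le_max_left _ _),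
      (le_max_left _ _).trans (le_max_right _ _), (le_max_right _ _).trans (le_max_right _ _)⟩
  set B : ℝ := (1 / β₀) ^ σ with hB
  have hB0 : 0 < B := Real.rpow_pos_of_pos (by positivity) _
  set m : ℝ := (C + C ^ 2) * (1 + g + k) with hm
  have hm0 : 0 < m := by positivity
  have hgC : g * C ≤ m := by
    rw [hm]
    have : 0 ≤ C * (1 + k) + C ^ 2 * (1 + g + k) := by positivity
    linarith
  have hgC2 : g * C ^ 2 ≤ m := by
    rw [hm]
    have : 0 ≤ C * (1 + g + k) + C ^ 2 * (1 + k) := by positivity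
    linarith
  have hkC2 : k * C ^ 2 ≤ m := by
    rw [hm]
    have : 0 ≤ C * (1 + g + k) + C ^ 2 * (1 + g) := by positivity
    linarith
  have hCC : C + C ^ 2 ≤ m := by
    rw [hm]
    have : 0 ≤ (C + C ^ 2) * (g + k) := by positivity
    linarith
  refine ⟨m * B * (4 * X + 1), by positivity, ?_⟩
  rintro α₀ α β γ t₀ ⟨hα, -, hβ1, hβ2, -, hγ⟩ ht₀
  have hβ : 0 < β := hβ₀.trans_le hβ1
  have hασ : 0 < α ^ σ := Real.rpow_pos_of_pos hα _
  have hαβ : (α * β) ^ σ ≤ B * α ^ σ := by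
    rw [Real.mul_rpow hα.le hβ.le, mul_comm]
    exact mul_le_mul_of_nonneg_right (Real.rpow_le_rpow hβ.le hβ2 hσ.le) hασ.le
  have hγβ : ‖γ / (β : ℂ)‖ ≤ g := by
    rw [norm_div, Complex.norm_real, Real.norm_of_nonneg hβ.le]
    exact div_le_div₀ (by positivity) hγ hβ₀ hβ1
  -- all the small quantities at time `t`
  have main : ∀ t, t₀ ≤ t →
      ‖pFun ν ξ α β γ t‖ ≤ m * B * α ^ σ * t ^ (-σ) ∧
      ‖pDeriv ν ξ α β γ t‖ ≤ m * B * α ^ σ * t ^ (-σ - 1) ∧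
      ‖remainder κ ν ξ α β γ t‖
        ≤ m * B * (4 * X) * α ^ σ * t ^ (-σ - 1) := by
    intro t ht'
    have ht : 0 < t := ht₀.trans_le ht'
    obtain ⟨hq0, hqC, hxC, hqν⟩ := hb α β t hα hβ ht
    have hx0 := hξ.scaled_pos hν hα hβ ht
    have hx1 := hξ.scaled_lt_one hν hα hβ ht
    have hη := eta_pos hν hξ hα hβ ht
    have hax := rpow_mul_eta (ν := ν) (ξ := ξ) (β := β) (t := t) hα
    have hp := pFun_eq (ν := ν) (ξ := ξ) (β := β) (γ := γ) hα t
    set x := ξ (-t / (α * β)) with hx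
    set η := eta ν ξ α β t with hηdef
    set q := η ^ ν / β with hq
    set a := α ^ (1 / ν) with ha
    have ht1 : 0 < t ^ (-σ) := Real.rpow_pos_of_pos ht _
    have ht2 : 0 < t ^ (-σ - 1) := Real.rpow_pos_of_pos ht _
    have hsplit : t ^ (-σ - 1) = t ^ (-σ) * (1 / t) := by
      rw [Real.rpow_sub ht, Real.rpow_one]
      ring
    set b := B * α ^ σ * t ^ (-σ - 1) with hbdef
    have hb0 : 0 < b := by positivity
    have hqb : |q - 1 / (ν * t)| ≤ C * b := by
      refine hqν.trans (mul_le_mul_of_nonneg_left ?_ hC.le)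
      exact mul_le_mul_of_nonneg_right hαβ ht2.le
    have hxq : x * q ≤ C ^ 2 * b := by
      calc x * q ≤ (C * ((B * α ^ σ) * t ^ (-σ))) * (C / t) := by
            refine mul_le_mul (hxC.trans ?_) hqC hq0.le (by positivity)
            exact mul_le_mul_of_nonneg_left (mul_le_mul_of_nonneg_right hαβ ht1.le) hC.le
        _ = C ^ 2 * b := by
            rw [hbdef, hsplit]
            ring
    have hxq0 : 0 ≤ x * q := by positivity
    refine ⟨?_, ?_, ?_⟩
    · rw [hp, norm_mul, Complex.norm_real, Real.norm_of_nonneg hx0.le]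
      calc ‖γ / (β : ℂ)‖ * x ≤ g * (C * ((B * α ^ σ) * t ^ (-σ))) := by
            refine mul_le_mul hγβ (hxC.trans ?_) hx0.le hg0.le
            exact mul_le_mul_of_nonneg_left (mul_le_mul_of_nonneg_right hαβ ht1.le) hC.le
        _ = g * C * (B * α ^ σ * t ^ (-σ)) := by ring
        _ ≤ m * (B * α ^ σ * t ^ (-σ)) := by gcongr
        _ = _ := by ring
    · have h1 : ‖((-(x * q * (1 - x)) : ℝ) : ℂ)‖ ≤ C ^ 2 * b := by
        rw [Complex.norm_real, norm_neg, Real.norm_of_nonneg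
          (mul_nonneg hxq0 (by linarith))]
        exact (mul_le_of_le_one_right hxq0 (by linarith)).trans hxq
      rw [pDeriv, norm_mul]
      calc ‖γ / (β : ℂ)‖ * ‖((-(x * q * (1 - x)) : ℝ) : ℂ)‖ ≤ g * (C ^ 2 * b) :=
            mul_le_mul hγβ h1 (norm_nonneg _) hg0.le
        _ = g * C ^ 2 * b := by ring
        _ ≤ m * b := by gcongr
        _ = _ := by
          rw [hbdef]
          ring
    · have r1 : ‖((q * (1 - a * η) - 1 / (ν * t) : ℝ) : ℂ)‖ ≤ m * b := by
        rw [Complex.norm_real, Real.norm_eq_abs, hax]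
        have h1 : q * (1 - x) - 1 / (ν * t) = (q - 1 / (ν * t)) + -(x * q) := by ring
        rw [h1]
        refine (abs_add_le _ _).trans ?_
        rw [abs_neg, abs_of_nonneg hxq0]
        have := mul_le_mul_of_nonneg_right hCC hb0.le
        linarith
      have r2 : ‖(a : ℂ) * (γ / (β : ℂ) ^ 2) * ((η ^ (ν + 1) : ℝ) : ℂ)‖ ≤ m * b := by
        have h1 : (a : ℂ) * (γ / (β : ℂ) ^ 2) * ((η ^ (ν + 1) : ℝ) : ℂ)
            = γ / (β : ℂ) * ((x * q : ℝ) : ℂ) := by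
          rw [← hax, hq, Real.rpow_add hη, Real.rpow_one]
          push_cast
          have : (β : ℂ) ≠ 0 := by exact_mod_cast hβ.ne'
          field_simp
        rw [h1, norm_mul, Complex.norm_real, Real.norm_of_nonneg hxq0]
        calc ‖γ / (β : ℂ)‖ * (x * q) ≤ g * (C ^ 2 * b) := mul_le_mul hγβ hxq hxq0 hg0.le
          _ = g * C ^ 2 * b := by ring
          _ ≤ m * b := by gcongr
      have r3 : ‖((α ^ (2 / ν) * (1 / β ^ κ) * η ^ (ν + 2) : ℝ) : ℂ)‖ ≤ m * b := by
        have h1 : α ^ (2 / ν) = a ^ 2 := by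
          rw [ha, ← Real.rpow_natCast, ← Real.rpow_mul hα.le]
          congr 1
          push_cast
          ring
        have h2 : η ^ (ν + 2) = η ^ ν * η ^ 2 := by
          rw [Real.rpow_add hη]
          norm_num
        have h3 : α ^ (2 / ν) * (1 / β ^ κ) * η ^ (ν + 2) = (β / β ^ κ) * x * (x * q) := by
          rw [h1, h2, ← hax, hq]
          field_simp
        have h4 : β / β ^ κ ≤ k := by
          have h5 : 1 / β ≤ 1 / β₀ := one_div_le_one_div_of_le hβ₀ hβ1
          have h6 : (1 / β) ^ 2 ≤ (1 / β₀) ^ 2 := by gcongr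
          have h7 : 0 < 1 / β₀ := by positivity
          rcases hκ with rfl | rfl
          · have : β / β ^ 2 = 1 / β := by field_simp
            have h8 : 0 < (1 / β₀) ^ 2 := by positivity
            rw [this, hk]
            linarith
          · have : β / β ^ 3 = (1 / β) ^ 2 := by field_simp
            rw [this, hk]
            linarith
        have h8 : 0 ≤ β / β ^ κ := by positivity
        rw [h3, Complex.norm_real, Real.norm_of_nonneg (by positivity)]
        calc β / β ^ κ * x * (x * q) ≤ k * 1 * (C ^ 2 * b) := by gcongr
          _ = k * C ^ 2 * b := by ring
          _ ≤ m * b := by gcongr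
      have r4 : ‖((q - 1 / (ν * t) : ℝ) : ℂ)‖ ≤ m * b := by
        rw [Complex.norm_real, Real.norm_eq_abs]
        have h1 := mul_le_mul_of_nonneg_right hCC hb0.le
        have h2 : 0 ≤ C ^ 2 * b := by positivity
        linarith
      have hn : ∀ {c : ℂ} {A : TriCoords →L[ℂ] TriCoords}, ‖c‖ ≤ m * b → ‖A‖ ≤ X →
          ‖c • A‖ ≤ m * b * X := fun h h' => by
          rw [norm_smul]
          exact mul_le_mul h h' (norm_nonneg _) (by positivity)
      refine (norm_add_le_of_le (norm_add_le_of_le (norm_add_le_of_le (hn r1 hX₁) (hn r2 hX₂))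
        (hn r3 hX₃)) (hn r4 hX₄)).trans (le_of_eq ?_)
      rw [hbdef]
      ring
  have hbig : ∀ z : ℝ, 0 ≤ z →
      m * B * α ^ σ * z ≤ m * B * (4 * X + 1) * α ^ σ * z := fun z hz => by
    have : 0 ≤ m * B * (4 * X) * α ^ σ * z := by positivity
    linarith
  refine ⟨fun t ht => hasDerivAt_pFun hν hξ hα hβ (ht₀.trans_le ht), fun t ht => ?_,
    fun t ht => ?_, fun t ht => ?_⟩
  · refine (main t ht).1.trans ?_
    exact hbig _ (Real.rpow_nonneg (ht₀.le.trans ht) _)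
  · refine (main t ht).2.1.trans ?_
    exact hbig _ (Real.rpow_nonneg (ht₀.le.trans ht) _)
  · refine (main t ht).2.2.trans ?_
    have : 0 ≤ m * B * α ^ σ * t ^ (-σ - 1) :=
      mul_nonneg (by positivity) (Real.rpow_nonneg (ht₀.le.trans ht) _)
    linarith

end Bounds

end KullAnisimov

namespace KullAnisimov

/-! ### Normalization of solutions -/

section Normalization

/-- Multiplying a solution by a non-vanishing scalar function `g` with `g' = m g` shifts the
generator by `m`. -/
theorem hasDerivAt_smul_iff {g m : ℝ → ℂ} {u : ℝ → TriCoords} {A : TriCoords →L[ℂ] TriCoords}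
    {t : ℝ} (hg : HasDerivAt g (m t * g t) t) (hg0 : g t ≠ 0) :
    HasDerivAt u (A (u t)) t ↔
      HasDerivAt (fun s => g s • u s) (A (g t • u t) + m t • (g t • u t)) t := by
  constructor
  · intro h
    refine (hg.smul h).congr_deriv ?_
    rw [map_smul, smul_smul]
  · intro h
    have hne : ∀ᶠ s in 𝓝 t, g s ≠ 0 := hg.continuousAt.eventually_ne hg0
    have h1 := ((hg.fun_inv hg0).smul h).congr_of_eventuallyEq (f₁ := u)
      (hne.mono fun s hs => (inv_smul_smul₀ hs (u s)).symm)
    refine h1.congr_deriv ?_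
    rw [map_smul, smul_add, inv_smul_smul₀ hg0, smul_smul, smul_smul, smul_smul, add_assoc,
      ← add_smul]
    have : (g t)⁻¹ * (m t * g t) + -(m t * g t) / g t ^ 2 * g t = 0 := by
      field_simp
      ring
    rw [← mul_assoc] at this
    rw [this, zero_smul, add_zero]

variable {ν : ℝ} {ξ : ℝ → ℝ} {α β : ℝ} {γ : ℂ} {τ : ℝ}

theorem hasDerivAt_rpow_ofReal {c t : ℝ} (ht : 0 < t) :
    HasDerivAt (fun t : ℝ => ((t ^ (-c) : ℝ) : ℂ))
      (-((c / t : ℝ) : ℂ) * ((t ^ (-c) : ℝ) : ℂ)) t := by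
  refine (Real.hasDerivAt_rpow_const (p := -c) (Or.inl ht.ne')).ofReal_comp.congr_deriv ?_
  rw [Real.rpow_sub ht, Real.rpow_one]
  push_cast
  ring

theorem hasDerivAt_psi (hξ : IsProfile ν ξ) (t : ℝ) :
    HasDerivAt (psi ν ξ α β γ τ) (pFun ν ξ α β γ t) t := by
  have hc := continuous_eta (α := α) (β := β) hξ
  have h := (intervalIntegral.integral_hasDerivAt_right (hc.intervalIntegrable τ t)
    (hc.stronglyMeasurableAtFilter _ _) hc.continuousAt).ofReal_comp.const_mul
    ((γ / (β : ℂ)) * ((α ^ (1 / ν) : ℝ) : ℂ))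
  refine h.congr_deriv ?_
  rw [pFun]
  ring

/-- The normalizing factor of the full system. -/
noncomputable def fullFactor (ν : ℝ) (ξ : ℝ → ℝ) (α β : ℝ) (γ : ℂ) (τ t : ℝ) : ℂ :=
  Complex.exp (2 * (t : ℂ) + psi ν ξ α β γ τ t) * ((t ^ (-(1 / (2 * ν))) : ℝ) : ℂ)

/-- The normalizing factor of the model system. -/
noncomputable def modelFactor (ν t : ℝ) : ℂ :=
  Complex.exp (2 * (t : ℂ)) * ((t ^ (-(1 / (2 * ν))) : ℝ) : ℂ)

theorem fullFactor_ne_zero {t : ℝ} (ht : 0 < t) : fullFactor ν ξ α β γ τ t ≠ 0 :=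
  mul_ne_zero (Complex.exp_ne_zero _)
    (Complex.ofReal_ne_zero.2 (Real.rpow_pos_of_pos ht _).ne')

theorem modelFactor_ne_zero {t : ℝ} (ht : 0 < t) : modelFactor ν t ≠ 0 :=
  mul_ne_zero (Complex.exp_ne_zero _)
    (Complex.ofReal_ne_zero.2 (Real.rpow_pos_of_pos ht _).ne')

theorem hasDerivAt_fullFactor (hξ : IsProfile ν ξ) {t : ℝ} (ht : 0 < t) :
    HasDerivAt (fullFactor ν ξ α β γ τ)
      ((2 + pFun ν ξ α β γ t - ((1 / (2 * ν) / t : ℝ) : ℂ)) * fullFactor ν ξ α β γ τ t) t := by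
  have h1 : HasDerivAt (fun t : ℝ => 2 * (t : ℂ)) 2 t := by
    simpa using (hasDerivAt_id t).ofReal_comp.const_mul (2 : ℂ)
  have h2 := ((h1.add (hasDerivAt_psi (α := α) (β := β) (γ := γ) (τ := τ) hξ t)).cexp).mul
    (hasDerivAt_rpow_ofReal (c := 1 / (2 * ν)) ht)
  refine h2.congr_deriv ?_
  simp only [fullFactor, Pi.add_apply]
  ring

theorem hasDerivAt_modelFactor {t : ℝ} (ht : 0 < t) :
    HasDerivAt (modelFactor ν) ((2 - ((1 / (2 * ν) / t : ℝ) : ℂ)) * modelFactor ν t) t := by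
  have h1 : HasDerivAt (fun t : ℝ => 2 * (t : ℂ)) 2 t := by
    simpa using (hasDerivAt_id t).ofReal_comp.const_mul (2 : ℂ)
  refine (h1.cexp.mul (hasDerivAt_rpow_ofReal (c := 1 / (2 * ν)) ht)).congr_deriv ?_
  simp only [modelFactor]
  ring

theorem coords_normalizedFull (U : ℝ → ThreeVec) (t : ℝ) :
    coords (normalizedFull ν ξ α β γ τ U t) = fullFactor ν ξ α β γ τ t • coords (U t) := by
  rw [normalizedFull, map_smul, fullFactor]

theorem coords_normalizedModel (Z : ℝ → ThreeVec) (t : ℝ) :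
    coords (normalizedModel ν Z t) = modelFactor ν t • coords (Z t) := by
  rw [normalizedModel, map_smul, modelFactor]

variable {κ : ℕ} {I : Set ℝ}

theorem isNormalizedFull_iff (hξ : IsProfile ν ξ) (hI : I ⊆ Ioi 0) {U : ℝ → ThreeVec} :
    IsNormalizedFull κ ν ξ α β γ τ I U ↔
      (∀ t ∈ I, HasDerivAt (fun s => fullFactor ν ξ α β γ τ s • coords (U s))
        ((splitData ν).gen (pFun ν ξ α β γ) (remainder κ ν ξ α β γ) t
          (fullFactor ν ξ α β γ τ t • coords (U t))) t) ∧
      Tendsto (fun t => fullFactor ν ξ α β γ τ t • coords (U t)) atTop (𝓝 (splitData ν).P) := by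
  refine and_congr (forall₂_congr fun t ht => ?_) ?_
  · rw [gen_full_apply]
    have h := hasDerivAt_smul_iff (u := fun s => coords (U s))
      (A := extOp (fullMatrix κ ν ξ α β γ t))
      (m := fun t => 2 + pFun ν ξ α β γ t - ((1 / (2 * ν) / t : ℝ) : ℂ))
      (hasDerivAt_fullFactor (α := α) (β := β) (γ := γ) (τ := τ) hξ (hI ht))
      (fullFactor_ne_zero (hI ht))
    rw [← h, extOp_apply, LinearEquiv.symm_apply_apply]
  · simp only [TendstoP0, coords_normalizedFull]
    rfl

theorem isNormalizedModel_iff (hI : I ⊆ Ioi 0) {Z : ℝ → ThreeVec} :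
    IsNormalizedModel ν I Z ↔
      (∀ t ∈ I, HasDerivAt (fun s => modelFactor ν s • coords (Z s))
        ((splitData ν).gen (fun _ => 0) (fun _ => 0) t (modelFactor ν t • coords (Z t))) t) ∧
      Tendsto (fun t => modelFactor ν t • coords (Z t)) atTop (𝓝 (splitData ν).P) := by
  refine and_congr (forall₂_congr fun t ht => ?_) ?_
  · rw [gen_model_apply]
    have h := hasDerivAt_smul_iff (u := fun s => coords (Z s))
      (A := extOp (modelMatrix ν t)) (m := fun t => 2 - ((1 / (2 * ν) / t : ℝ) : ℂ))
      (hasDerivAt_modelFactor (ν := ν) (hI ht)) (modelFactor_ne_zero (hI ht))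
    rw [← h, extOp_apply, LinearEquiv.symm_apply_apply]
  · simp only [TendstoP0, coords_normalizedModel]
    rfl

/-- Removal of a non-vanishing factor. -/
theorem exists_smul_coords_eq {g : ℝ → ℂ} (hg : ∀ t, 0 < t → g t ≠ 0) (V : ℝ → TriCoords) :
    ∃ U : ℝ → ThreeVec, ∀ t, 0 < t → g t • coords (U t) = V t :=
  ⟨fun t => coords.symm ((g t)⁻¹ • V t), fun t ht => by
    rw [LinearEquiv.apply_symm_apply, smul_inv_smul₀ (hg t ht)]⟩

theorem eqOn_of_eqOn_smul_coords {g : ℝ → ℂ} (hg : ∀ t, 0 < t → g t ≠ 0) (hI : I ⊆ Ioi 0)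
    {U W : ℝ → ThreeVec} (h : EqOn (fun t => g t • coords (U t)) (fun t => g t • coords (W t)) I) :
    EqOn U W I := fun t ht =>
  coords.injective (smul_right_injective _ (hg t (hI ht)) (h ht))

end Normalization

section Transfer

variable {ν : ℝ} {ξ : ℝ → ℝ} {κ : ℕ}

/-- A decay exponent which is admissible for every `ν`. -/
theorem exists_exponent (hν : 0 < ν) : ∃ σ : ℝ, 0 < σ ∧ σ < 1 ∧ σ * ν ≤ 1 := by
  refine ⟨min (1 / 2) (1 / ν), by positivity, (min_le_left _ _).trans_lt (by norm_num), ?_⟩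
  have := mul_le_mul_of_nonneg_right (min_le_right (1 / 2) (1 / ν)) hν.le
  rwa [one_div_mul_cancel hν.ne'] at this

/-- A solution of the normalized equation with limit `P`, in the original variables, together with
its uniqueness. -/
theorem exists_unique_of_gen {g p p' : ℝ → ℂ} {R : ℝ → TriCoords →L[ℂ] TriCoords} {σ ε : ℝ}
    (hσ : 0 < σ) (hσ1 : σ < 1) (hε : 0 ≤ ε) (hg : ∀ t, 0 < t → g t ≠ 0)
    (hadm : SplitData.Admissible σ ε 1 p p' R)
    (hcont : ContinuousOn ((splitData ν).gen p R) (Ioi 0)) {Q : Set ℝ → (ℝ → ThreeVec) → Prop}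
    (hQ : ∀ I, I ⊆ Ioi 0 → ∀ U, Q I U ↔
      (∀ t ∈ I, HasDerivAt (fun s => g s • coords (U s))
        ((splitData ν).gen p R t (g t • coords (U t))) t) ∧
      Tendsto (fun t => g t • coords (U t)) atTop (𝓝 (splitData ν).P)) :
    ∃ U₀ : ℝ → ThreeVec, Q (Ioi 0) U₀ ∧
      ∀ a : ℝ, 0 ≤ a → ∀ U : ℝ → ThreeVec, Q (Ioi a) U → EqOn U U₀ (Ioi a) := by
  obtain ⟨V, hV, hVl⟩ := (splitData ν).exists_tendsto hσ hσ1.le hε hadm hcont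
  obtain ⟨U₀, hU₀⟩ := exists_smul_coords_eq hg V
  have hQ₀ : Q (Ioi 0) U₀ := by
    refine (hQ _ subset_rfl U₀).2 ⟨fun t ht => ?_, ?_⟩
    · rw [hU₀ t ht]
      refine (hV t ht).congr_of_eventuallyEq ?_
      filter_upwards [Ioi_mem_nhds ht] with s hs using hU₀ s hs
    · refine hVl.congr' ?_
      filter_upwards [eventually_gt_atTop 0] with s hs using (hU₀ s hs).symm
  refine ⟨U₀, hQ₀, fun a ha U hU => ?_⟩
  have hIa : Ioi a ⊆ Ioi 0 := Ioi_subset_Ioi ha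
  obtain ⟨h1, h2⟩ := (hQ _ hIa U).1 hU
  obtain ⟨h3, h4⟩ := (hQ _ subset_rfl U₀).1 hQ₀
  exact eqOn_of_eqOn_smul_coords hg hIa ((splitData ν).eqOn_of_tendsto hσ hσ1.le hε ha hadm hcont
    h1 (fun t ht => h3 t (hIa ht)) h2 h4)

end Transfer

end KullAnisimov

open KullAnisimov in
theorem theorem4p1 (ν : ℝ) (hν : 0 < ν) (ξ : ℝ → ℝ) (hξ : KullAnisimov.IsProfile ν ξ)
    (κ : ℕ) (hκ : κ = 2 ∨ κ = 3) :
    -- existence and uniqueness for the full system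
    (∀ (α β : ℝ) (γ : ℂ) (τ : ℝ), 0 < α → 0 < β → 0 ≤ γ.re → 0 < τ →
      ∃ U₀ : ℝ → KullAnisimov.ThreeVec,
        KullAnisimov.IsNormalizedFull κ ν ξ α β γ τ (Set.Ioi 0) U₀ ∧
        ∀ (a : ℝ), 0 ≤ a → ∀ U : ℝ → KullAnisimov.ThreeVec,
          KullAnisimov.IsNormalizedFull κ ν ξ α β γ τ (Set.Ioi a) U →
            Set.EqOn U U₀ (Set.Ioi a)) ∧
    -- the bound
    (∀ α₀ β₀ t₀ : ℝ, 0 < α₀ → 0 < β₀ → 0 < t₀ → ∃ C : ℝ, 0 < C ∧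
      ∀ (α β : ℝ) (γ : ℂ) (τ : ℝ) (U₀ : ℝ → KullAnisimov.ThreeVec),
        KullAnisimov.ParamRange α₀ β₀ α β γ → 0 < τ →
        KullAnisimov.IsNormalizedFull κ ν ξ α β γ τ (Set.Ioi 0) U₀ →
        ∀ t : ℝ, t₀ ≤ t →
          ‖KullAnisimov.coords
            (Complex.exp (2 * (t : ℂ) + KullAnisimov.psi ν ξ α β γ τ t) • U₀ t)‖
            ≤ C * t ^ (1 / (2 * ν))) ∧
    -- existence and uniqueness for the model system
    (∃ Z : ℝ → KullAnisimov.ThreeVec,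
      KullAnisimov.IsNormalizedModel ν (Set.Ioi 0) Z ∧
      ∀ (a : ℝ), 0 ≤ a → ∀ Z' : ℝ → KullAnisimov.ThreeVec,
        KullAnisimov.IsNormalizedModel ν (Set.Ioi a) Z' → Set.EqOn Z' Z (Set.Ioi a)) ∧
    -- the comparison
    (1 < ν → ∀ α₀ β₀ t₀ : ℝ, 0 < α₀ → 0 < β₀ → 0 < t₀ → ∃ C : ℝ, 0 < C ∧
      ∀ (α β : ℝ) (γ : ℂ) (τ : ℝ) (U₀ Z : ℝ → KullAnisimov.ThreeVec),
        KullAnisimov.ParamRange α₀ β₀ α β γ → 0 < τ →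
        KullAnisimov.IsNormalizedFull κ ν ξ α β γ τ (Set.Ioi 0) U₀ →
        KullAnisimov.IsNormalizedModel ν (Set.Ioi 0) Z →
        ∀ t : ℝ, t₀ ≤ t →
          ‖KullAnisimov.coords (KullAnisimov.normalizedModel ν Z t
              - KullAnisimov.normalizedFull ν ξ α β γ τ U₀ t)‖
            ≤ C * α ^ (1 / ν)) := by
  obtain ⟨σ, hσ, hσ1, hσν⟩ := exists_exponent hν
  refine ⟨?_, ?_, ?_, ?_⟩
  · intro α β γ τ hα hβ hγ _
    -- every single parameter lies in one of the ranges over which the estimates are uniform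
    set β₀ := min (min β (1 / β)) (1 / (‖γ‖ + 1)) with hβ₀def
    have hβ₀ : 0 < β₀ := by positivity
    have hβ₁ : β₀ ≤ 1 / β := (min_le_left _ _).trans (min_le_right _ _)
    have hβ₂ : β₀ ≤ 1 / (‖γ‖ + 1) := min_le_right _ _
    obtain ⟨C, hC, hadm⟩ := exists_admissible hν hξ hκ hσ hσ1 hσν hβ₀
    have hrange : ParamRange α β₀ α β γ := by
      refine ⟨hα, le_rfl, (min_le_left _ _).trans (min_le_left _ _), ?_, hγ, ?_⟩
      · rwa [le_one_div hβ hβ₀]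
      · have := (le_one_div hβ₀ (by positivity)).1 hβ₂
        linarith
    exact exists_unique_of_gen hσ hσ1 (by positivity) (fun t ht => fullFactor_ne_zero ht)
      (hadm α α β γ 1 hrange one_pos) (continuousOn_gen_full hν hξ hα hβ)
      fun I hI U => isNormalizedFull_iff hξ hI
  · intro α₀ β₀ t₀ hα₀ hβ₀ ht₀
    obtain ⟨C, hC, hadm⟩ := exists_admissible hν hξ hκ hσ hσ1 hσν hβ₀
    obtain ⟨M, hM, hbound⟩ := (splitData ν).exists_norm_le (ε₀ := C * α₀ ^ σ) hσ hσ1.le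
      (by positivity) ht₀
    refine ⟨M, hM, fun α β γ τ U₀ hr _ hU₀ t ht => ?_⟩
    have hα := hr.1
    have ht' : 0 < t := ht₀.trans_le ht
    obtain ⟨h1, h2⟩ := (isNormalizedFull_iff hξ subset_rfl).1 hU₀
    have h3 := hbound (C * α ^ σ) _ _ _ _ (by positivity)
      (mul_le_mul_of_nonneg_left (Real.rpow_le_rpow hα.le hr.2.1 hσ.le) hC.le)
      (hadm α₀ α β γ t₀ hr ht₀) h1 h2 t ht
    have h4 : t ^ (1 / (2 * ν)) * t ^ (-(1 / (2 * ν))) = 1 := by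
      rw [← Real.rpow_add ht', add_neg_cancel, Real.rpow_zero]
    have h5 : coords (Complex.exp (2 * (t : ℂ) + psi ν ξ α β γ τ t) • U₀ t)
        = ((t ^ (1 / (2 * ν)) : ℝ) : ℂ) • (fullFactor ν ξ α β γ τ t • coords (U₀ t)) := by
      rw [map_smul, smul_smul, fullFactor, mul_left_comm, ← Complex.ofReal_mul, h4,
        Complex.ofReal_one, mul_one]
    rw [h5, norm_smul, Complex.norm_real, Real.norm_of_nonneg (Real.rpow_nonneg ht'.le _), mul_comm]
    exact mul_le_mul_of_nonneg_right h3 (Real.rpow_nonneg ht'.le _)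
  · exact exists_unique_of_gen hσ hσ1 le_rfl (fun t ht => modelFactor_ne_zero ht)
      (SplitData.admissible_zero σ 1) continuousOn_gen_model
      fun I hI Z => isNormalizedModel_iff hI
  · intro hν1 α₀ β₀ t₀ hα₀ hβ₀ ht₀
    -- for `ν > 1` the exponent `1/ν` itself is admissible
    have hs : 0 < 1 / ν := by positivity
    have hs1 : 1 / ν < 1 := (div_lt_one hν).2 hν1
    obtain ⟨C, hC, hadm⟩ := exists_admissible hν hξ hκ hs hs1 (one_div_mul_cancel hν.ne').le hβ₀
    obtain ⟨M, hM, hbound⟩ := (splitData ν).exists_norm_sub_le (ε₀ := C * α₀ ^ (1 / ν)) hs hs1.le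
      (by positivity) ht₀
    refine ⟨M * C, by positivity, fun α β γ τ U₀ Z hr _ hU₀ hZ t ht => ?_⟩
    have hα := hr.1
    obtain ⟨h1, h2⟩ := (isNormalizedFull_iff hξ subset_rfl).1 hU₀
    obtain ⟨h3, h4⟩ := (isNormalizedModel_iff subset_rfl).1 hZ
    have h5 := hbound (C * α ^ (1 / ν)) _ _ _ _ _ (by positivity)
      (mul_le_mul_of_nonneg_left (Real.rpow_le_rpow hα.le hr.2.1 hs.le) hC.le)
      (hadm α₀ α β γ t₀ hr ht₀) h1 h3 h2 h4 t ht
    rw [map_sub, coords_normalizedFull, coords_normalizedModel, norm_sub_rev, mul_assoc]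
    exact h5
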